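/- **Notation.** All Hilbert spaces are complex and $\otimes$ between Hilbert spaces is the Hilbert tensor product. Let $k\ge 1$, $\mathbf n=(n_1,\dots,n_k)\in\mathbb N^k$, and let $\mathcal E$ be a Hilbert space. Let $\mathbb F_{n_i}^+$ be the free monoid on $n_i$ generators $g^i_1,\dots,g^i_{n_i}$, and $|\alpha|$ the length of a word $\alpha$. The full Fock space $F^2(H_{n_i})$ has the orthonormal basis $\{e^i_\alpha:\alpha\in\mathbb F_{n_i}^+\}$. Put $\mathcal F:=F^2(H_{n_1})\otimes\cdots\otimes F^2(H_{n_k})$. On $\mathcal F$, $\mathbf S_{i,j}$ acts on the $i$-th tensor factor by $e^i_\alpha\mapsto e^i_{g^i_j\alpha}$ and as the identity on the other factors; $\mathbf R_{i,j}$ is defined likewise by $e^i_\alpha\mapsto e^i_{\alpha g^i_j}$. Write $\mathbf S=\{\mathbf S_{i,j}\}$. *Polyball.* For a Hilbert space $\mathcal H$, the regular polyball $\mathbf B_{\mathbf n}(\mathcal H)$ is the set of all $\mathbf X=(X_1,\dots,X_k)$, $X_i=(X_{i,1},\dots,X_{i,n_i})\in B(\mathcal H)^{n_i}$, such that $X_{s,p}X_{t,q}=X_{t,q}X_{s,p}$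 whenever $s\ne t$, $\|\sum_j X_{i,j}X_{i,j}^*\|<1$ for every $i$, and $\mathbf\Delta_{\mathbf X}(I)$ is positive and invertible, where $\mathbf\Delta_{\mathbf X}=(\mathrm{id}-\Phi_{X_1})\circ\cdots\circ(\mathrm{id}-\Phi_{X_k})$ and $\Phi_{X_i}(Y)=\sum_jX_{i,j}YX_{i,j}^*$. For words put $X_{i,\alpha}:=X_{i,j_1}\cdots X_{i,j_p}$ if $\alpha=g^i_{j_1}\cdots g^i_{j_p}$. One has $r\mathbf S\in\mathbf B_{\mathbf n}(\mathcal F)$ for $0\le r<1$. *Berezin transform.* $\mathbf K_{\mathbf X}:\mathcal H\to\mathcal F\otimes\mathcal H$ is the bounded operator $$\mathbf K_{\mathbf X}h=\sum_{\beta_1,\dots,\beta_k}e^1_{\beta_1}\otimes\cdots\otimes e^k_{\beta_k}\otimes\mathbf\Delta_{\mathbf X}(I)^{1/2}X_{1,\beta_1}^*\cdots X_{k,\beta_k}^*h,$$ and for $A\in B(\mathcal E\otimes\mathcal F)$ put $\mathcal B^{ext}_{\mathbf X}[A]:=(I_{\mathcal E}\otimes\mathbf K_{\mathbf X}^*)(A\otimes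 I_{\mathcal H})(I_{\mathcal E}\otimes\mathbf K_{\mathbf X})$. *Multi-Toeplitz operators.* $\mathcal T_{\mathbf n}$ is the space of all $A\in B(\mathcal E\otimes\mathcal F)$ with $(I_{\mathcal E}\otimes\mathbf R_{i,s}^*)A(I_{\mathcal E}\otimes\mathbf R_{i,t})=\delta_{st}A$ for all $i$ and all $s,t\in\{1,\dots,n_i\}$. *Free pluriharmonic functions.* $B(\mathcal E)\otimes_{min}B(\mathcal H)\subset B(\mathcal E\otimes\mathcal H)$ is the norm closure of the span of the operators $a\otimes b$. A function $F$ on the (abstract) polyball with coefficients in $B(\mathcal E)$ consists of maps $F:\mathbf B_{\mathbf n}(\mathcal H)\to B(\mathcal E)\otimes_{min}B(\mathcal H)$, one for every Hilbert space $\mathcal H$. It is *free $k$-pluriharmonic* if there are $A_{(\alpha_1,\dots,\alpha_k;\beta_1,\dots,\beta_k)}\in B(\mathcal E)$ such that for every $\mathcal H$ and every $\mathbf X\in\mathbf B_{\mathbf n}(\mathcal H)$ $$F(\mathbf X)=\sum_{m_1\in\mathbb Z}\cdots\sum_{m_k\in\mathbb Z}\ \sum_{|\alpha_i|=m_i^-,\,|\beta_i|=m_i^+}A_{(\alpha_1,\dots,\alpha_k;\beta_1,\dots,\beta_k)}\otimes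 X_{1,\alpha_1}\cdots X_{k,\alpha_k}X_{1,\beta_1}^*\cdots X_{k,\beta_k}^*,$$ where $m^+=\max(m,0)$, $m^-=\max(-m,0)$, and the (iterated) series converge in operator norm, a series over $\mathbb Z$ being the sum of the series over $m\ge 0$ and the series over $m<0$. It is *bounded* if $\sup_{\mathbf X\in\mathbf B_{\mathbf n}(\mathcal H)}\|F(\mathbf X)\|<\infty$ for every $\mathcal H$. Let $\mathbf{PH}^\infty_{\mathcal E}(\mathbf B_{\mathbf n})$ be the vector space of all bounded free $k$-pluriharmonic functions with coefficients in $B(\mathcal E)$, with the matrix norms $\|[F_{ij}]_m\|_m:=\sup\|[F_{ij}(\mathbf X)]_m\|$, where the supremum is over all Hilbert spaces $\mathcal H$ and all $\mathbf X\in\mathbf B_{\mathbf n}(\mathcal H)$. **Theorem.** 1. For a function $F$ on the polyball with coefficients in $B(\mathcal E)$ the following are equivalent: (i) $F$ is a bounded free $k$-pluriharmonic function; (ii) there is $A\in\mathcal T_{\mathbf n}$ such that $F(\mathbf X)=\mathcal B^{ext}_{\mathbf X}[A]$ for every Hilbert space $\mathcal H$ and every $\mathbf X\in\mathbf B_{\mathbf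 n}(\mathcal H)$. Likewise, for one fixed Hilbert space $\mathcal H$, a map $f:\mathbf B_{\mathbf n}(\mathcal H)\to B(\mathcal E)\otimes_{min}B(\mathcal H)$ is the restriction to $\mathbf B_{\mathbf n}(\mathcal H)$ of a bounded free $k$-pluriharmonic function iff there is $A\in\mathcal T_{\mathbf n}$ with $f(\mathbf X)=\mathcal B^{ext}_{\mathbf X}[A]$ for all $\mathbf X\in\mathbf B_{\mathbf n}(\mathcal H)$. 2. In this case $A=\text{SOT-}\lim_{r\to1}F(r\mathbf S)$. More precisely, if $F$ is a bounded free $k$-pluriharmonic function, $A\in\mathcal T_{\mathbf n}$, and $F(\mathbf X)=\mathcal B^{ext}_{\mathbf X}[A]$ for all $\mathbf X\in\mathbf B_{\mathbf n}(\mathcal H)$ for some infinite dimensional $\mathcal H$, then $F(r\mathbf S)x\to Ax$ as $r\to1$, $r<1$, for every $x\in\mathcal E\otimes\mathcal F$. 3. The map $\Phi:\mathbf{PH}^\infty_{\mathcal E}(\mathbf B_{\mathbf n})\to\mathcal T_{\mathbf n}$, $\Phi(F):=A$, is a well-defined linear bijection and is completely isometric: $\|[F_{ij}]_m\|_m=\|[\Phi(F_{ij})]_m\|$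 for every $m$ and every $m\times m$ matrix $[F_{ij}]_m$ over $\mathbf{PH}^\infty_{\mathcal E}(\mathbf B_{\mathbf n})$, where $[\Phi(F_{ij})]_m$ acts on the $m$-fold Hilbert direct sum of $\mathcal E\otimes\mathcal F$. -/

import Mathlib

open scoped TensorProduct
open Filter Topology UniformSpace

universe u v

namespace Polyball

section HilbertTensor

variable (E : Type*) [NormedAddCommGroup E] [InnerProductSpace ℂ E]
variable (H : Type*) [NormedAddCommGroup H] [InnerProductSpace ℂ H]

/-- The Hilbert tensor product of `E` and `H`: the completion of the algebraic tensor product. -/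
def HTensor : Type _ := Completion (E ⊗[ℂ] H)

namespace HTensor

noncomputable instance instNormedAddCommGroup : NormedAddCommGroup (HTensor E H) :=
  inferInstanceAs (NormedAddCommGroup (Completion (E ⊗[ℂ] H)))

noncomputable instance instInnerProductSpace : InnerProductSpace ℂ (HTensor E H) :=
  inferInstanceAs (InnerProductSpace ℂ (Completion (E ⊗[ℂ] H)))

instance instCompleteSpace : CompleteSpace (HTensor E H) :=
  inferInstanceAs (CompleteSpace (Completion (E ⊗[ℂ] H)))

/-- The canonical embedding of the algebraic tensor product. -/
noncomputable def emb : E ⊗[ℂ] H →ₗᵢ[ℂ] HTensor E H where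
  toFun z := (z : Completion (E ⊗[ℂ] H))
  map_add' := Completion.coe_add
  map_smul' := Completion.coe_smul
  norm_map' := Completion.norm_coe

theorem denseRange_emb : DenseRange (emb E H) := Completion.denseRange_coe

end HTensor

attribute [irreducible] HTensor HTensor.instNormedAddCommGroup HTensor.instInnerProductSpace

variable {E H}

/-- The elementary tensor of `x` and `y`, in the Hilbert tensor product. -/
noncomputable def tmul (x : E) (y : H) : HTensor E H := HTensor.emb E H (x ⊗ₜ[ℂ] y)

theorem inner_tmul (x x' : E) (y y' : H) :
    inner ℂ (tmul x y) (tmul x' y') = inner ℂ x x' * inner ℂ y y' := by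
  simp [tmul]

variable {E' : Type*} [NormedAddCommGroup E'] [InnerProductSpace ℂ E']
variable {H' : Type*} [NormedAddCommGroup H'] [InnerProductSpace ℂ H']

/-- The tensor product of two bounded operators. -/
noncomputable def opTensor (a : E →L[ℂ] E') (b : H →L[ℂ] H') : HTensor E H →L[ℂ] HTensor E' H' :=
  ((HTensor.emb E' H').toContinuousLinearMap ∘L TensorProduct.mapL a b).extend
    (HTensor.emb E H).toContinuousLinearMap

theorem opTensor_emb (a : E →L[ℂ] E') (b : H →L[ℂ] H') (z : E ⊗[ℂ] H) :
    opTensor a b (HTensor.emb E H z) = HTensor.emb E' H' (TensorProduct.mapL a b z) :=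
  ContinuousLinearMap.extend_eq _ (HTensor.denseRange_emb E H)
    (HTensor.emb E H).isometry.isUniformInducing z

theorem opTensor_tmul (a : E →L[ℂ] E') (b : H →L[ℂ] H') (x : E) (y : H) :
    opTensor a b (tmul x y) = tmul (a x) (b y) :=
  opTensor_emb a b _

variable (E H) in
/-- The spatial (minimal) tensor product of the algebras `B(E)` and `B(H)`: the norm closure, in
the bounded operators on the Hilbert tensor product, of the span of the elementary tensors. -/
noncomputable def minTensor : Submodule ℂ (HTensor E H →L[ℂ] HTensor E H) :=
  (Submodule.span ℂ {T | ∃ (a : E →L[ℂ] E) (b : H →L[ℂ] H), T = opTensor a b}).topologicalClosure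

variable {G : Type*} [NormedAddCommGroup G] [InnerProductSpace ℂ G]

variable (E H G) in
/-- The canonical embedding of `(E ⊗ H) ⊗ G`. -/
noncomputable def leftEmb : (E ⊗[ℂ] H) ⊗[ℂ] G →ₗᵢ[ℂ] HTensor (HTensor E H) G :=
  (HTensor.emb (HTensor E H) G).comp
    (TensorProduct.mapIsometry (HTensor.emb E H) LinearIsometry.id)

variable (E H G) in
/-- The canonical embedding of `E ⊗ (H ⊗ G)`. -/
noncomputable def rightEmb : E ⊗[ℂ] (H ⊗[ℂ] G) →ₗᵢ[ℂ] HTensor E (HTensor H G) :=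
  (HTensor.emb E (HTensor H G)).comp
    (TensorProduct.mapIsometry LinearIsometry.id (HTensor.emb H G))

theorem denseRange_leftEmb : DenseRange (leftEmb E H G) := by
  refine (HTensor.denseRange_emb (HTensor E H) G).comp ?_ (HTensor.emb _ _).continuous
  set T := TensorProduct.mapIsometry (HTensor.emb E H) (LinearIsometry.id : G →ₗᵢ[ℂ] G)
  intro z
  change z ∈ (LinearMap.range T.toLinearMap).topologicalClosure
  induction z using TensorProduct.induction_on with
  | zero => exact zero_mem _
  | add x y hx hy => exact add_mem hx hy
  | tmul w g =>
    refine (HTensor.denseRange_emb E H).induction_on w ?_ fun w => ?_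
    · exact IsClosed.preimage (f := fun w => w ⊗ₜ[ℂ] g)
        (by fun_prop) (Submodule.isClosed_topologicalClosure _)
    · exact Submodule.le_topologicalClosure _ ⟨w ⊗ₜ g, rfl⟩

theorem denseRange_rightEmb : DenseRange (rightEmb E H G) := by
  refine (HTensor.denseRange_emb E (HTensor H G)).comp ?_ (HTensor.emb _ _).continuous
  set T := TensorProduct.mapIsometry (LinearIsometry.id : E →ₗᵢ[ℂ] E) (HTensor.emb H G)
  intro z
  change z ∈ (LinearMap.range T.toLinearMap).topologicalClosure
  induction z using TensorProduct.induction_on with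
  | zero => exact zero_mem _
  | add x y hx hy => exact add_mem hx hy
  | tmul e w =>
    refine (HTensor.denseRange_emb H G).induction_on w ?_ fun w => ?_
    · exact IsClosed.preimage (f := fun w => e ⊗ₜ[ℂ] w)
        (by fun_prop) (Submodule.isClosed_topologicalClosure _)
    · exact Submodule.le_topologicalClosure _ ⟨e ⊗ₜ w, rfl⟩

variable (E H G) in
/-- The canonical unitary `(E ⊗ H) ⊗ G ≃ E ⊗ (H ⊗ G)` of Hilbert tensor products. -/
noncomputable def assoc : HTensor (HTensor E H) G ≃ₗᵢ[ℂ] HTensor E (HTensor H G) :=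
  (TensorProduct.assoc ℂ E H G).extendOfIsometry (leftEmb E H G).toLinearMap
    (rightEmb E H G).toLinearMap denseRange_leftEmb denseRange_rightEmb fun x => by
      change ‖rightEmb E H G (TensorProduct.assocIsometry ℂ E H G x)‖ = ‖leftEmb E H G x‖
      simp only [LinearIsometry.norm_map, LinearIsometryEquiv.norm_map]

theorem assoc_tmul (x : E) (y : H) (z : G) :
    assoc E H G (tmul (tmul x y) z) = tmul x (tmul y z) :=
  LinearEquiv.extendOfIsometry_eq (TensorProduct.assoc ℂ E H G) (leftEmb E H G).toLinearMap
    (rightEmb E H G).toLinearMap denseRange_leftEmb denseRange_rightEmb _ ((x ⊗ₜ y) ⊗ₜ z)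

end HilbertTensor

section Fock

variable {k : ℕ}

/-- `k`-tuples of words, i.e. the direct product of the free semigroups on `n i` generators. -/
abbrev Word (n : Fin k → ℕ) : Type := ∀ i, List (Fin (n i))

/-- The tensor product of the full Fock spaces on `n i` generators, realised as the `ℓ²` space on
`k`-tuples of words (lifted to the universe of the Hilbert spaces under consideration). -/
abbrev Fock (n : Fin k → ℕ) : Type u := lp (fun _ : ULift.{u} (Word n) => ℂ) 2

variable {n : Fin k → ℕ}

/-- The basis vector `e_{α_1} ⊗ ⋯ ⊗ e_{α_k}`. -/
noncomputable def fockBasis (α : Word n) : Fock.{u} n := lp.single 2 (ULift.up α) 1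

theorem orthonormal_fockBasis : Orthonormal ℂ (fockBasis.{u} (n := n)) := by
  classical
  rw [orthonormal_iff_ite]
  intro α β
  rw [fockBasis, fockBasis, lp.inner_single_left, lp.single_apply]
  by_cases h : α = β
  · subst h; simp
  · rw [Pi.single_eq_of_ne (by simpa using h)]; simp [h]

/-- The isometry of the Fock space which maps `e_α` to `e_{σ α}`, for an injective `σ`. -/
noncomputable def shift (σ : Word n → Word n) (hσ : Function.Injective σ) :
    Fock.{u} n →L[ℂ] Fock.{u} n :=
  ((orthonormal_fockBasis.comp (fun β : ULift.{u} (Word n) => σ β.down)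
    (hσ.comp ULift.down_injective)).orthogonalFamily.linearIsometry).toContinuousLinearMap

theorem shift_basis (σ : Word n → Word n) (hσ : Function.Injective σ) (α : Word n) :
    shift.{u} σ hσ (fockBasis α) = fockBasis (σ α) := by
  simp [shift, fockBasis]

theorem injective_cons (i : Fin k) (j : Fin (n i)) :
    Function.Injective fun α : Word n => Function.update α i (j :: α i) := by
  intro α β h
  funext l
  have hl := congrFun h l
  by_cases hli : l = i
  · subst hli; simpa using hl
  · simpa [Function.update_of_ne hli] using hl

theorem injective_snoc (i : Fin k) (j : Fin (n i)) :
    Function.Injective fun α : Word n => Function.update α i (α i ++ [j]) := by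
  intro α β h
  funext l
  have hl := congrFun h l
  by_cases hli : l = i
  · subst hli; simpa using hl
  · simpa [Function.update_of_ne hli] using hl

variable (n) in
/-- The left creation operators `S_{i,j}`: `e_α ↦ e_β`, where `β` is `α` with the generator
`g_j` put in front of its `i`-th word. -/
noncomputable def leftCreation (i : Fin k) (j : Fin (n i)) : Fock.{u} n →L[ℂ] Fock.{u} n :=
  shift (fun α => Function.update α i (j :: α i)) (injective_cons i j)

variable (n) in
/-- The right creation operators `R_{i,j}`: `e_α ↦ e_β`, where `β` is `α` with the generator
`g_j` put at the end of its `i`-th word. -/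
noncomputable def rightCreation (i : Fin k) (j : Fin (n i)) : Fock.{u} n →L[ℂ] Fock.{u} n :=
  shift (fun α => Function.update α i (α i ++ [j])) (injective_snoc i j)

end Fock

section Polyball

variable {k : ℕ}

/-- Tuples `X = (X_1, …, X_k)`, with `X_i = (X_{i,1}, …, X_{i,n_i})`, of bounded operators. -/
abbrev Tuple (n : Fin k → ℕ) (H : Type*) [NormedAddCommGroup H] [InnerProductSpace ℂ H] : Type _ :=
  ∀ i, Fin (n i) → (H →L[ℂ] H)

variable {H : Type*} [NormedAddCommGroup H] [InnerProductSpace ℂ H]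

/-- `T_w = T_{j_1} ⋯ T_{j_p}` for the word `w = g_{j_1} ⋯ g_{j_p}`. -/
noncomputable def wordProd {m : ℕ} (T : Fin m → (H →L[ℂ] H)) (w : List (Fin m)) : H →L[ℂ] H :=
  (w.map T).prod

/-- `X_α = X_{1,α_1} ⋯ X_{k,α_k}`. -/
noncomputable def monomial {n : Fin k → ℕ} (X : Tuple n H) (α : Word n) : H →L[ℂ] H :=
  (List.ofFn fun i => wordProd (X i) (α i)).prod

variable [CompleteSpace H]

/-- The completely positive map `Φ_T : Y ↦ ∑ j, T_j Y T_j^*`. -/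
noncomputable def cpMap {m : ℕ} (T : Fin m → (H →L[ℂ] H)) :
    Module.End ℂ (H →L[ℂ] H) where
  toFun Y := ∑ j, T j * Y * star (T j)
  map_add' Y Z := by simp [mul_add, add_mul, Finset.sum_add_distrib]
  map_smul' c Y := by simp [Finset.smul_sum]

/-- The defect operator `Δ_X(I)`, where `Δ_X = (id - Φ_{X_1}) ∘ ⋯ ∘ (id - Φ_{X_k})`. -/
noncomputable def defect {n : Fin k → ℕ} (X : Tuple n H) : H →L[ℂ] H :=
  ((List.ofFn fun i => 1 - cpMap (X i)).prod : Module.End ℂ (H →L[ℂ] H)) 1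

/-- The regular polyball `B_n(H)`. -/
def polyball (n : Fin k → ℕ) (H : Type*) [NormedAddCommGroup H] [InnerProductSpace ℂ H]
    [CompleteSpace H] : Set (Tuple n H) :=
  {X | (∀ s t, s ≠ t → ∀ p q, X s p * X t q = X t q * X s p) ∧
    (∀ i, ‖∑ j, X i j * star (X i j)‖ < 1) ∧ IsStrictlyPositive (defect X)}

end Polyball

section Kernel

theorem sum_words_length {H : Type*} [NormedAddCommGroup H] [InnerProductSpace ℂ H]
    [CompleteSpace H] {m : ℕ} (T : Fin m → (H →L[ℂ] H)) (p : ℕ) (h : H) :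
    ∑ a : Fin p → Fin m, ‖star (wordProd T (List.ofFn a)) h‖ ^ 2 ≤
      ‖∑ j, T j * star (T j)‖ ^ p * ‖h‖ ^ 2 := by
  induction p generalizing h with
  | zero => simp [wordProd]
  | succ p ih =>
    rw [← (Fin.consEquiv fun _ => Fin m).sum_comp, Fintype.sum_prod_type]
    have key : ∑ j, ‖star (T j) h‖ ^ 2 ≤ ‖∑ j, T j * star (T j)‖ * ‖h‖ ^ 2 := by
      have h1 : ∑ j, ‖star (T j) h‖ ^ 2 = RCLike.re (inner ℂ ((∑ j, T j * star (T j)) h) h) := by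
        simp only [_root_.sum_apply, sum_inner, map_sum]
        refine Finset.sum_congr rfl fun j _ => ?_
        rw [mul_apply_eq_comp, ContinuousLinearMap.star_eq_adjoint,
          ← ContinuousLinearMap.adjoint_inner_right, inner_self_eq_norm_sq]
      rw [h1]
      calc _ ≤ ‖(∑ j, T j * star (T j)) h‖ * ‖h‖ := re_inner_le_norm _ _
        _ ≤ (‖∑ j, T j * star (T j)‖ * ‖h‖) * ‖h‖ := by
          gcongr; exact ContinuousLinearMap.le_opNorm _ _
        _ = _ := by ring
    calc _ = ∑ j, ∑ a : Fin p → Fin m,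
          ‖star (wordProd T (List.ofFn a)) (star (T j) h)‖ ^ 2 := by
          refine Finset.sum_congr rfl fun j _ => Finset.sum_congr rfl fun a _ => ?_
          simp [Fin.consEquiv, wordProd, List.ofFn_succ, star_mul]
      _ ≤ ∑ j, ‖∑ j, T j * star (T j)‖ ^ p * ‖star (T j) h‖ ^ 2 :=
          Finset.sum_le_sum fun j _ => ih _
      _ ≤ _ := by
          rw [← Finset.mul_sum, pow_succ, mul_assoc]
          gcongr

theorem tsum_words {H : Type*} [NormedAddCommGroup H] [InnerProductSpace ℂ H]
    [CompleteSpace H] {m : ℕ} (T : Fin m → (H →L[ℂ] H)) (hT : ‖∑ j, T j * star (T j)‖ < 1)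
    (h : H) :
    ∑' w : List (Fin m), ENNReal.ofReal (‖star (wordProd T w) h‖ ^ 2) ≤
      ENNReal.ofReal (1 - ‖∑ j, T j * star (T j)‖)⁻¹ * ENNReal.ofReal (‖h‖ ^ 2) := by
  set ρ := ‖∑ j, T j * star (T j)‖
  rw [← List.equivSigmaTuple.symm.tsum_eq, ENNReal.tsum_sigma']
  calc _ ≤ ∑' p : ℕ, ENNReal.ofReal (ρ ^ p * ‖h‖ ^ 2) := by
        refine ENNReal.tsum_le_tsum fun p => ?_
        rw [tsum_fintype, ← ENNReal.ofReal_sum_of_nonneg fun _ _ => by positivity]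
        exact ENNReal.ofReal_le_ofReal (sum_words_length T p h)
    _ = _ := by
        rw [← ENNReal.ofReal_tsum_of_nonneg (fun p => by positivity)
          ((summable_geometric_of_lt_one (norm_nonneg _) hT).mul_right _), tsum_mul_right,
          tsum_geometric_of_lt_one (norm_nonneg _) hT, ENNReal.ofReal_mul (by
            have := sub_pos.2 hT; positivity)]

theorem tsum_monomial {H : Type*} [NormedAddCommGroup H] [InnerProductSpace ℂ H]
    [CompleteSpace H] : ∀ {k : ℕ} {n : Fin k → ℕ} (X : Tuple n H)
    (_ : ∀ i, ‖∑ j, X i j * star (X i j)‖ < 1), ∃ C : ℝ, 0 ≤ C ∧ ∀ h,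
    ∑' α : Word n, ENNReal.ofReal (‖star (monomial X α) h‖ ^ 2) ≤
      ENNReal.ofReal C * ENNReal.ofReal (‖h‖ ^ 2)
  | 0, n, X, _ => ⟨1, zero_le_one, fun h => by
      rw [tsum_fintype]; simp [monomial]⟩
  | k + 1, n, X, hX => by
      obtain ⟨C, hC0, hC⟩ := tsum_monomial (fun i => X i.succ) (fun i => hX i.succ)
      have h0 : 0 ≤ (1 - ‖∑ j, X 0 j * star (X 0 j)‖)⁻¹ := inv_nonneg.2 (sub_nonneg.2 (hX 0).le)
      refine ⟨C * (1 - ‖∑ j, X 0 j * star (X 0 j)‖)⁻¹, by positivity, fun h => ?_⟩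
      rw [← (Fin.consEquiv fun i => List (Fin (n i))).tsum_eq, ENNReal.tsum_prod']
      calc _ = ∑' w : List (Fin (n 0)), ∑' α : Word fun i : Fin k => n i.succ, ENNReal.ofReal
            (‖star (monomial (fun i => X i.succ) α) (star (wordProd (X 0) w) h)‖ ^ 2) := by
            refine tsum_congr fun w => tsum_congr fun α => ?_
            simp [Fin.consEquiv, monomial, List.ofFn_succ, star_mul]
        _ ≤ ∑' w : List (Fin (n 0)), ENNReal.ofReal C *
              ENNReal.ofReal (‖star (wordProd (X 0) w) h‖ ^ 2) :=
            ENNReal.tsum_le_tsum fun w => hC _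
        _ ≤ _ := by
            rw [ENNReal.tsum_mul_left, ENNReal.ofReal_mul hC0, mul_assoc]
            gcongr
            exact tsum_words (X 0) (hX 0) h

variable {k : ℕ} {n : Fin k → ℕ} {H : Type u} [NormedAddCommGroup H] [InnerProductSpace ℂ H]
  [CompleteSpace H]

/-- The operator `Δ_X(I)^{1/2} X_α^*`. -/
noncomputable def kernelCoeff (X : Tuple n H) (α : Word n) : H →L[ℂ] H :=
  CFC.sqrt (defect X) * star (monomial X α)

theorem kernelCoeff_bound (X : polyball n H) : ∃ C : ℝ, 0 ≤ C ∧ ∀ h,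
    Summable (fun α : ULift.{u} (Word n) => ‖kernelCoeff X.1 α.down h‖ ^ 2) ∧
    ∑' α : ULift.{u} (Word n), ‖kernelCoeff X.1 α.down h‖ ^ 2 ≤ C * ‖h‖ ^ 2 := by
  obtain ⟨C, hC0, hC⟩ := tsum_monomial X.1 X.2.2.1
  have main : ∀ h, Summable (fun α : Word n => ‖star (monomial X.1 α) h‖ ^ 2) ∧
      ∑' α : Word n, ‖star (monomial X.1 α) h‖ ^ 2 ≤ C * ‖h‖ ^ 2 := by
    intro h
    have hs : Summable (fun α : Word n => ‖star (monomial X.1 α) h‖ ^ 2) := by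
      have hne : ∑' α : Word n, ENNReal.ofReal (‖star (monomial X.1 α) h‖ ^ 2) ≠ ⊤ :=
        ((hC h).trans_lt (ENNReal.mul_lt_top ENNReal.ofReal_lt_top ENNReal.ofReal_lt_top)).ne
      refine (ENNReal.summable_toReal hne).congr fun α => ?_
      rw [ENNReal.toReal_ofReal (by positivity)]
    refine ⟨hs, ?_⟩
    have := hC h
    rwa [← ENNReal.ofReal_tsum_of_nonneg (fun _ => by positivity) hs, ← ENNReal.ofReal_mul hC0,
      ENNReal.ofReal_le_ofReal_iff (by positivity)] at this
  refine ⟨‖CFC.sqrt (defect X.1)‖ ^ 2 * C, by positivity, fun h => ?_⟩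
  have hle : ∀ α : Word n, ‖kernelCoeff X.1 α h‖ ^ 2 ≤
      ‖CFC.sqrt (defect X.1)‖ ^ 2 * ‖star (monomial X.1 α) h‖ ^ 2 := fun α => by
    rw [← mul_pow]
    gcongr
    exact (CFC.sqrt (defect X.1)).le_opNorm (star (monomial X.1 α) h)
  have hs2 := (main h).1.mul_left (‖CFC.sqrt (defect X.1)‖ ^ 2)
  have hs1 := Summable.of_nonneg_of_le (fun _ => by positivity) hle hs2
  refine ⟨Equiv.ulift.{u}.summable_iff.2 hs1, ?_⟩
  refine (Equiv.ulift.{u}.tsum_eq fun α : Word n => ‖kernelCoeff X.1 α h‖ ^ 2).trans_le ?_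
  refine (hs1.tsum_le_tsum hle hs2).trans ?_
  rw [tsum_mul_left, mul_assoc]
  gcongr
  exact (main h).2

/-- The operator from `H` to the Hilbert sum of copies of `H`, with the entries
`Δ_X(I)^{1/2} X_α^*`. -/
noncomputable def kernelColumn (X : polyball n H) :
    H →L[ℂ] lp (fun _ : ULift.{u} (Word n) => H) 2 :=
  LinearMap.mkContinuousOfExistsBound
    { toFun := fun h => ⟨fun α => kernelCoeff X.1 α.down h, memℓp_gen (by
        simpa using ((kernelCoeff_bound X).choose_spec.2 h).1)⟩
      map_add' := fun x y => by ext α; simp; rfl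
      map_smul' := fun c x => by ext α; simp }
    (by
      obtain ⟨C, hC0, hC⟩ := kernelCoeff_bound X
      refine ⟨Real.sqrt C, fun h => ?_⟩
      refine (pow_le_pow_iff_left₀ (norm_nonneg _) (by positivity) two_ne_zero).1 ?_
      rw [mul_pow, Real.sq_sqrt hC0]
      have := lp.norm_rpow_eq_tsum (p := 2) (by norm_num)
        (⟨fun α => kernelCoeff X.1 α.down h, memℓp_gen (by
        simpa using (hC h).1)⟩ : lp (fun _ : ULift.{u} (Word n) => H) 2)
      simp only [ENNReal.toReal_ofNat, Real.rpow_ofNat] at this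
      exact this.trans_le (hC h).2)

theorem orthogonalFamily_tmul {H : Type u} [NormedAddCommGroup H] [InnerProductSpace ℂ H] :
    OrthogonalFamily ℂ (fun _ : ULift.{u} (Word n) => H)
    (fun α => ({ toFun := fun x => tmul (fockBasis.{u} α.down) x
                 map_add' := fun x y => by
                  simp [tmul, TensorProduct.tmul_add]
                 map_smul' := fun c x => by simp [tmul]
                 norm_map' := fun x => by
                  simp [tmul, orthonormal_fockBasis.1] } : H →ₗᵢ[ℂ] HTensor (Fock.{u} n) H)) := by
  intro α β hαβ x y
  change inner ℂ (tmul _ x) (tmul _ y) = 0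
  rw [inner_tmul, orthonormal_fockBasis.2 fun h => hαβ (ULift.down_injective h), zero_mul]

/-- The noncommutative Berezin kernel `K_X h = ∑ α, e_α ⊗ Δ_X(I)^{1/2} X_α^* h`. As `Δ_X(I)` is
invertible, the closure of its range is `H`. -/
noncomputable def berezinKernel (X : polyball n H) : H →L[ℂ] HTensor (Fock.{u} n) H :=
  orthogonalFamily_tmul.linearIsometry.toContinuousLinearMap ∘L kernelColumn X

theorem hasSum_berezinKernel (X : polyball n H) (h : H) :
    HasSum (fun α : ULift.{u} (Word n) =>
      tmul (fockBasis.{u} α.down) (CFC.sqrt (defect X.1) (star (monomial X.1 α.down) h)))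
      (berezinKernel X h) :=
  orthogonalFamily_tmul.hasSum_linearIsometry (kernelColumn X h)

end Kernel

section UniversalModel

variable {k : ℕ} {n : Fin k → ℕ}

theorem leftCreation_basis (i : Fin k) (j : Fin (n i)) (α : Word n) :
    leftCreation.{u} n i j (fockBasis α) = fockBasis (Function.update α i (j :: α i)) :=
  shift_basis _ _ _

theorem fock_ext {x y : Fock.{u} n}
    (h : ∀ α : Word n, inner ℂ (fockBasis α) x = inner ℂ (fockBasis α) y) : x = y := by
  ext α
  have := h α.down
  simpa [fockBasis, lp.inner_single_left] using this

theorem fock_hasSum (x : Fock.{u} n) :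
    HasSum (fun α : ULift.{u} (Word n) => x α • fockBasis.{u} α.down) x := by
  have := lp.hasSum_single (by norm_num) x
  refine this.congr_fun ?_
  intro α
  ext β
  simp [fockBasis, Pi.single_apply]

theorem fock_op_ext {S T : Fock.{u} n →L[ℂ] Fock.{u} n}
    (h : ∀ α : Word n, S (fockBasis α) = T (fockBasis α)) : S = T := by
  ext1 x
  have hS := (fock_hasSum x).mapL S
  have hT := (fock_hasSum x).mapL T
  simp only [map_smul, h] at hS hT
  exact hS.unique hT

theorem inner_fockBasis (α β : Word n) :
    inner ℂ (fockBasis.{u} α) (fockBasis β) = if α = β then (1 : ℂ) else 0 := by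
  classical
  rw [orthonormal_iff_ite.1 orthonormal_fockBasis]

theorem star_leftCreation_basis (i : Fin k) (j : Fin (n i)) (α : Word n) :
    star (leftCreation.{u} n i j) (fockBasis α) =
      if α i ≠ [] ∧ (α i).head? = some j then fockBasis (Function.update α i (α i).tail) else 0 := by
  refine fock_ext fun β => ?_
  rw [ContinuousLinearMap.star_eq_adjoint, ContinuousLinearMap.adjoint_inner_right,
    leftCreation_basis, inner_fockBasis]
  have hiff : Function.update β i (j :: β i) = α ↔
      ((α i ≠ [] ∧ (α i).head? = some j) ∧ β = Function.update α i (α i).tail) := by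
    constructor
    · rintro rfl
      simp
    · rintro ⟨⟨h1, h2⟩, rfl⟩
      funext l
      by_cases hl : l = i
      · subst hl
        obtain ⟨a, t, hat⟩ := List.exists_cons_of_ne_nil h1
        simp_all
      · simp [Function.update_of_ne hl]
  by_cases h : α i ≠ [] ∧ (α i).head? = some j
  · rw [if_pos h, inner_fockBasis]
    simp only [hiff, h, true_and, ne_eq, not_false_eq_true]
  · rw [if_neg h, inner_zero_right, if_neg fun h' => h (hiff.1 h').1]

/-- The tuple `r S = (r S_{i,j})`. -/
noncomputable def scaledModel (n : Fin k → ℕ) (r : ℝ) : Tuple n (Fock.{u} n) :=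
  fun i j => (r : ℂ) • leftCreation n i j

theorem cpMap_scaledModel (r : ℝ) (i : Fin k) (D : Fock.{u} n →L[ℂ] Fock.{u} n)
    (d : Word n → ℝ) (hD : ∀ α, D (fockBasis α) = (d α : ℂ) • fockBasis α) (α : Word n) :
    cpMap (scaledModel.{u} n r i) D (fockBasis α) =
      ((if α i = [] then 0 else r ^ 2 * d (Function.update α i (α i).tail) : ℝ) : ℂ) •
        fockBasis α := by
  have hterm : ∀ j, (scaledModel.{u} n r i j * D * star (scaledModel.{u} n r i j)) (fockBasis α) =
      if α i ≠ [] ∧ (α i).head? = some j then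
        ((r ^ 2 * d (Function.update α i (α i).tail) : ℝ) : ℂ) • fockBasis α else 0 := by
    intro j
    simp only [scaledModel, mul_apply_eq_comp, star_smul, _root_.smul_apply,
      star_leftCreation_basis]
    by_cases h : α i ≠ [] ∧ (α i).head? = some j
    · simp only [if_pos h, map_smul, hD, leftCreation_basis]
      have hα : Function.update (Function.update α i (α i).tail) i
          (j :: (Function.update α i (α i).tail) i) = α := by
        funext l
        by_cases hl : l = i
        · subst hl
          obtain ⟨a, t, hat⟩ := List.exists_cons_of_ne_nil h.1
          simp_all
        · simp [Function.update_of_ne hl]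
      rw [hα, smul_smul, smul_smul]
      congr 1
      rw [Complex.star_def, Complex.conj_ofReal]
      push_cast
      ring
    · simp [if_neg h]
  change (∑ j, scaledModel.{u} n r i j * D * star (scaledModel.{u} n r i j)) (fockBasis α) = _
  rw [_root_.sum_apply, Finset.sum_congr rfl fun j _ => hterm j]
  rcases hα : α i with _ | ⟨a, t⟩
  · simp
  · simp

theorem prod_cpMap_scaledModel (r : ℝ) (l : List (Fin k)) (hl : l.Nodup) (α : Word n) :
    (((l.map fun i => 1 - cpMap (scaledModel.{u} n r i)).prod :
      Module.End ℂ (Fock.{u} n →L[ℂ] Fock.{u} n)) 1) (fockBasis α) =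
      (((l.map fun i => if α i = [] then 1 else 1 - r ^ 2).prod : ℝ) : ℂ) • fockBasis α := by
  induction l generalizing α with
  | nil => simp
  | cons i l ih =>
    obtain ⟨hi, hl⟩ := List.nodup_cons.1 hl
    have hupd : ∀ α : Word n,
        (l.map fun s => if (Function.update α i (α i).tail) s = [] then (1 : ℝ) else 1 - r ^ 2) =
        l.map fun s => if α s = [] then (1 : ℝ) else 1 - r ^ 2 := by
      intro α
      refine List.map_congr_left fun s hs => ?_
      have : s ≠ i := fun h => hi (h ▸ hs)
      rw [Function.update_of_ne this]
    rw [List.map_cons, List.prod_cons, Module.End.mul_apply, LinearMap.sub_apply,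
      Module.End.one_apply, _root_.sub_apply, ih hl,
      cpMap_scaledModel r i _ _ (fun α => ih hl α), hupd, ← sub_smul, List.map_cons,
      List.prod_cons]
    congr 1
    by_cases h : α i = []
    · simp [h]
    · simp only [if_neg h]
      push_cast
      ring

theorem isStrictlyPositive_of_diagonal (D : Fock.{u} n →L[ℂ] Fock.{u} n) (d : Word n → ℝ)
    (hD : ∀ α, D (fockBasis α) = (d α : ℂ) • fockBasis α) (c : ℝ) (hc : 0 < c)
    (hd : ∀ α, c ≤ d α) : IsStrictlyPositive D := by
  have h1 : IsStrictlyPositive (c • (1 : Fock.{u} n →L[ℂ] Fock.{u} n)) :=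
    ⟨by
      rw [ContinuousLinearMap.nonneg_iff_isPositive, ContinuousLinearMap.isPositive_iff_complex]
      intro x
      have h : inner ℂ ((c • (1 : Fock.{u} n →L[ℂ] Fock.{u} n)) x) x =
          ((c * ‖x‖ ^ 2 : ℝ) : ℂ) := by
        change inner ℂ ((c : ℂ) • x) x = _
        rw [inner_smul_left, inner_self_eq_norm_sq_to_K, Complex.conj_ofReal]
        push_cast
        rfl
      rw [h]
      rw [RCLike.re_eq_complex_re, Complex.ofReal_re]
      exact ⟨rfl, mul_nonneg hc.le (sq_nonneg ‖x‖)⟩,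
      isUnit_one.smul (Units.mk0 c hc.ne')⟩
  refine IsStrictlyPositive.of_le h1 ?_
  rw [ContinuousLinearMap.le_def, ContinuousLinearMap.isPositive_iff_complex]
  intro x
  have hcoord : ∀ α : ULift.{u} (Word n), (D x) α = (d α.down : ℂ) * x α := by
    intro α
    have hs := ((fock_hasSum x).mapL D).mapL (innerSL ℂ (fockBasis α.down))
    have h2 := hs.unique (hasSum_single α (fun β hβ => by
      simp only [map_smul, hD, innerSL_apply_apply, inner_fockBasis]
      rw [if_neg fun h => hβ (ULift.down_injective h.symm)]
      simp))
    simp only [map_smul, hD, innerSL_apply_apply, inner_fockBasis, if_true] at h2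
    have h4 : inner ℂ (fockBasis α.down) (D x) = (D x) α := by
      rw [fockBasis, lp.inner_single_left]
      simp
    rw [h4] at h2
    rw [h2, smul_eq_mul, smul_eq_mul]
    ring
  have hin := lp.hasSum_inner (𝕜 := ℂ) ((D - c • 1) x) x
  have hterm : ∀ α : ULift.{u} (Word n), inner ℂ (((D - c • 1) x) α) (x α) =
      (((d α.down - c) * ‖x α‖ ^ 2 : ℝ) : ℂ) := by
    intro α
    have : ((D - c • 1) x) α =
        ((d α.down - c : ℝ) : ℂ) * x α := by
      change (D x) α - (c : ℂ) * x α = _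
      rw [hcoord]
      push_cast
      ring
    rw [this, ← smul_eq_mul, inner_smul_left, inner_self_eq_norm_sq_to_K]
    simp
  simp only [hterm] at hin
  have hre := Complex.hasSum_re hin
  have him := Complex.hasSum_im hin
  simp only [Complex.ofReal_re, Complex.ofReal_im] at hre him
  constructor
  · apply Complex.ext
    · simp
    · simpa using hasSum_zero.unique him
  · simpa using hre.nonneg fun α => mul_nonneg (sub_nonneg.2 (hd _)) (by positivity)

theorem scaledModel_mem_polyball (n : Fin k → ℕ) (r : ℝ) (hr : r ∈ Set.Ico (0 : ℝ) 1) :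
    scaledModel.{u} n r ∈ polyball n (Fock.{u} n) := by
  have hr2 : r ^ 2 < 1 := pow_lt_one₀ hr.1 hr.2 two_ne_zero
  refine ⟨fun s t hst p q => ?_, fun i => ?_, ?_⟩
  · refine fock_op_ext fun α => ?_
    simp only [scaledModel, mul_apply_eq_comp, _root_.smul_apply, map_smul,
      leftCreation_basis]
    rw [Function.update_of_ne hst, Function.update_of_ne hst.symm, Function.update_comm hst]
  · have hle : ‖∑ j, scaledModel.{u} n r i j * star (scaledModel.{u} n r i j)‖ ≤ r ^ 2 := by
      set P := ∑ j, leftCreation.{u} n i j * star (leftCreation.{u} n i j) with hP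
      have hS : ∑ j, scaledModel.{u} n r i j * star (scaledModel.{u} n r i j) =
          ((r ^ 2 : ℝ) : ℂ) • P := by
        rw [hP, Finset.smul_sum]
        refine Finset.sum_congr rfl fun j _ => ?_
        simp only [scaledModel, star_smul, Complex.star_def, Complex.conj_ofReal, smul_mul_assoc,
          mul_smul_comm, smul_smul, ← Complex.ofReal_mul, pow_two]
      have hPb : ∀ α, P (fockBasis α) = (if α i = [] then (0 : ℂ) else 1) • fockBasis α := by
        intro α
        have := cpMap_scaledModel.{u} (n := n) 1 i 1 (fun _ => 1) (by simp) α
        have h2 : cpMap (scaledModel.{u} n 1 i) 1 = P := by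
          change ∑ j, scaledModel.{u} n 1 i j * 1 * star (scaledModel.{u} n 1 i j) = P
          simp [scaledModel, hP]
        rw [h2] at this
        rw [this]
        by_cases h : α i = [] <;> simp [h]
      have hPidem : P * P = P := by
        refine fock_op_ext fun α => ?_
        rw [mul_apply_eq_comp, hPb, map_smul, hPb]
        by_cases h : α i = [] <;> simp [h]
      have hPstar : star P = P := by simp [hP, star_sum]
      have hPn : ‖P‖ ≤ 1 := by
        have h3 : ‖P‖ * ‖P‖ = ‖P‖ := by
          rw [← CStarRing.norm_star_mul_self, hPstar, hPidem]
        nlinarith [norm_nonneg P]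
      rw [hS, norm_smul, Complex.norm_real, Real.norm_of_nonneg (by positivity)]
      exact mul_le_of_le_one_right (by positivity) hPn
    exact hle.trans_lt hr2
  · have hdiag := fun α => prod_cpMap_scaledModel.{u} (n := n) r (List.finRange k)
      (List.nodup_finRange k) α
    refine isStrictlyPositive_of_diagonal (defect (scaledModel.{u} n r)) _
      (fun α => by rw [← hdiag α, defect, List.ofFn_eq_map]) ((1 - r ^ 2) ^ k)
      (pow_pos (sub_pos.2 hr2) k) fun α => ?_
    have : ∀ l : List (Fin k), (1 - r ^ 2) ^ l.length ≤
        (l.map fun i => if α i = [] then (1 : ℝ) else 1 - r ^ 2).prod := by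
      intro l
      induction l with
      | nil => simp
      | cons i l ih =>
        rw [List.length_cons, pow_succ', List.map_cons, List.prod_cons]
        have h1 : 0 ≤ 1 - r ^ 2 := (sub_pos.2 hr2).le
        refine mul_le_mul ?_ ih (pow_nonneg h1 _) ?_
        · split_ifs
          · nlinarith [sq_nonneg r]
          · exact le_rfl
        · split_ifs
          · exact zero_le_one
          · exact h1
    simpa using this (List.finRange k)

end UniversalModel

section Toeplitz

variable {k : ℕ} (n : Fin k → ℕ)
variable (E : Type v) [NormedAddCommGroup E] [InnerProductSpace ℂ E]

/-- The `k`-multi-Toeplitz operators on `E ⊗ ⨂_i F²(H_{n_i})`: those `A` which satisfy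
`(I ⊗ R_{i,s}^*) A (I ⊗ R_{i,t}) = δ_{st} A`. -/
noncomputable def multiToeplitz :
    Submodule ℂ (HTensor E (Fock.{u} n) →L[ℂ] HTensor E (Fock.{u} n)) where
  carrier := {A | ∀ (i : Fin k) (s t : Fin (n i)),
    opTensor (ContinuousLinearMap.id ℂ E) (star (rightCreation.{u} n i s)) ∘L A ∘L
      opTensor (ContinuousLinearMap.id ℂ E) (rightCreation.{u} n i t) =
        if s = t then A else 0}
  zero_mem' i s t := by simp
  add_mem' {A B} hA hB i s t := by
    rw [ContinuousLinearMap.add_comp, ContinuousLinearMap.comp_add, hA, hB]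
    split_ifs <;> simp
  smul_mem' c A hA i s t := by
    rw [ContinuousLinearMap.smul_comp, ContinuousLinearMap.comp_smul, hA]
    split_ifs <;> simp

variable {n E}

/-- The extended noncommutative Berezin transform
`B_X^ext[A] = (I_E ⊗ K_X^*) (A ⊗ I_H) (I_E ⊗ K_X)`. -/
noncomputable def berezinExt [CompleteSpace E] {H : Type u} [NormedAddCommGroup H]
    [InnerProductSpace ℂ H] [CompleteSpace H] (X : polyball n H)
    (A : HTensor E (Fock.{u} n) →L[ℂ] HTensor E (Fock.{u} n)) :
    HTensor E H →L[ℂ] HTensor E H :=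
  opTensor (ContinuousLinearMap.id ℂ E) (ContinuousLinearMap.adjoint (berezinKernel X)) ∘L
    (assoc E (Fock.{u} n) H : _ →L[ℂ] HTensor E (HTensor (Fock.{u} n) H)) ∘L
    opTensor A (ContinuousLinearMap.id ℂ H) ∘L
    ((assoc E (Fock.{u} n) H).symm : _ →L[ℂ] HTensor (HTensor E (Fock.{u} n)) H) ∘L
    opTensor (ContinuousLinearMap.id ℂ E) (berezinKernel X)

end Toeplitz

section IteratedSum

variable {V : Type*} [NormedAddCommGroup V]

/-- The two-sided series `∑_{m ∈ ℤ} f m` converges to `s`: the series over `m < 0` and the series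
over `m ≥ 0` both converge, and `s` is the sum of the two limits. -/
def HasIntSum (f : ℤ → V) (s : V) : Prop :=
  ∃ s₁ s₂ : V, Tendsto (fun N : ℕ => ∑ m ∈ Finset.range N, f (-(m + 1 : ℤ))) atTop (𝓝 s₁) ∧
    Tendsto (fun N : ℕ => ∑ m ∈ Finset.range N, f (m : ℤ)) atTop (𝓝 s₂) ∧ s = s₁ + s₂

/-- The iterated series `∑_{m_1 ∈ ℤ} ⋯ ∑_{m_k ∈ ℤ} f (m_1, …, m_k)` converges to `s`. -/
def HasIterSum : (k : ℕ) → ((Fin k → ℤ) → V) → V → Prop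
  | 0, f, s => f Fin.elim0 = s
  | k + 1, f, s => ∃ g : ℤ → V,
      (∀ m, HasIterSum k (fun t => f (Fin.cons m t)) (g m)) ∧ HasIntSum g s

theorem HasIntSum.add {f g : ℤ → V} {s t : V} (hf : HasIntSum f s) (hg : HasIntSum g t) :
    HasIntSum (fun m => f m + g m) (s + t) := by
  obtain ⟨s₁, s₂, h₁, h₂, rfl⟩ := hf
  obtain ⟨t₁, t₂, h₃, h₄, rfl⟩ := hg
  refine ⟨s₁ + t₁, s₂ + t₂, ?_, ?_, by abel⟩
  · simpa only [Finset.sum_add_distrib] using h₁.add h₃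
  · simpa only [Finset.sum_add_distrib] using h₂.add h₄

theorem HasIntSum.smul [NormedSpace ℂ V] (c : ℂ) {f : ℤ → V} {s : V} (hf : HasIntSum f s) :
    HasIntSum (fun m => c • f m) (c • s) := by
  obtain ⟨s₁, s₂, h₁, h₂, rfl⟩ := hf
  refine ⟨c • s₁, c • s₂, ?_, ?_, smul_add _ _ _⟩
  · simpa only [Finset.smul_sum] using h₁.const_smul c
  · simpa only [Finset.smul_sum] using h₂.const_smul c

theorem HasIterSum.zero : ∀ {k : ℕ}, HasIterSum k (fun _ => (0 : V)) 0
  | 0 => rfl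
  | _ + 1 => ⟨fun _ => 0, fun _ => HasIterSum.zero, 0, 0, by simp, by simp, by simp⟩

theorem HasIterSum.add : ∀ {k : ℕ} {f g : (Fin k → ℤ) → V} {s t : V},
    HasIterSum k f s → HasIterSum k g t → HasIterSum k (fun m => f m + g m) (s + t)
  | 0, _, _, _, _, hf, hg => by
      simp only [HasIterSum] at hf hg ⊢
      rw [hf, hg]
  | _ + 1, _, _, _, _, ⟨a, ha, ha'⟩, ⟨b, hb, hb'⟩ =>
      ⟨fun m => a m + b m, fun m => HasIterSum.add (ha m) (hb m), ha'.add hb'⟩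

theorem HasIterSum.smul [NormedSpace ℂ V] (c : ℂ) : ∀ {k : ℕ} {f : (Fin k → ℤ) → V} {s : V},
    HasIterSum k f s → HasIterSum k (fun m => c • f m) (c • s)
  | 0, _, _, hf => by
      simp only [HasIterSum] at hf ⊢
      rw [hf]
  | _ + 1, _, _, ⟨a, ha, ha'⟩ =>
      ⟨fun m => c • a m, fun m => HasIterSum.smul c (ha m), ha'.smul c⟩

end IteratedSum

section Pluriharmonic

/-- A complex Hilbert space, as a bundled object. -/
structure HilbSpace : Type (u + 1) where
  carrier : Type u
  [normed : NormedAddCommGroup carrier]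
  [inner : InnerProductSpace ℂ carrier]
  [complete : CompleteSpace carrier]

instance : CoeSort HilbSpace.{u} (Type u) := ⟨HilbSpace.carrier⟩

attribute [instance] HilbSpace.normed HilbSpace.inner HilbSpace.complete

variable {k : ℕ} (n : Fin k → ℕ)
variable (E : Type v) [NormedAddCommGroup E] [InnerProductSpace ℂ E]

/-- Functions on the regular polyball with coefficients in `B(E)`: they assign to every Hilbert
space `H` a map `B_n(H) → B(E) ⊗_min B(H)`. -/
abbrev PolyballFunction : Type _ :=
  ∀ H : HilbSpace.{u}, polyball n H → minTensor E H

variable {n E}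

/-- The part of multidegree `m ∈ ℤ^k` of a free pluriharmonic series with the coefficients `A`:
the finite sum of `A_{(α;β)} ⊗ X_α X_β^*` over all `α, β` with `|α_i| = m_i^-` and
`|β_i| = m_i^+`. -/
noncomputable def multiPart {H : Type*} [NormedAddCommGroup H] [InnerProductSpace ℂ H]
    [CompleteSpace H] (A : Word n → Word n → (E →L[ℂ] E)) (X : Tuple n H) (m : Fin k → ℤ) :
    HTensor E H →L[ℂ] HTensor E H :=
  ∑ a : ∀ i, Fin (-m i).toNat → Fin (n i), ∑ b : ∀ i, Fin (m i).toNat → Fin (n i),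
    opTensor (A (fun i => List.ofFn (a i)) (fun i => List.ofFn (b i)))
      (monomial X (fun i => List.ofFn (a i)) * star (monomial X fun i => List.ofFn (b i)))

/-- Free `k`-pluriharmonic functions with coefficients in `B(E)`: there are coefficients
`A_{(α;β)}` in `B(E)` such that, on every Hilbert space, `F(X)` is the norm-convergent iterated sum
over `m_1, …, m_k` in `ℤ` of the parts of multidegree `m`. -/
def IsFreePluriharmonic (F : PolyballFunction.{u} n E) : Prop :=
  ∃ A : Word n → Word n → (E →L[ℂ] E),
    ∀ (H : HilbSpace.{u}) (X : polyball n H), HasIterSum k (multiPart A X.1) (F H X).1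

/-- A function on the polyball is bounded if its representation on any Hilbert space is bounded. -/
def IsBoundedFunction (F : PolyballFunction.{u} n E) : Prop :=
  ∀ H : HilbSpace.{u}, ∃ C : ℝ, ∀ X : polyball n H, ‖(F H X).1‖ ≤ C

theorem opTensor_add_left {H : Type*} [NormedAddCommGroup H] [InnerProductSpace ℂ H]
    (a b : E →L[ℂ] E) (c : H →L[ℂ] H) :
    opTensor (a + b) c = opTensor a c + opTensor b c := by
  ext z
  refine (HTensor.denseRange_emb E H).induction_on z
    (isClosed_eq (by fun_prop) (by fun_prop)) fun z => ?_
  rw [_root_.add_apply, opTensor_emb, opTensor_emb, opTensor_emb, TensorProduct.mapL_add_left,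
    _root_.add_apply, map_add]

theorem opTensor_smul_left {H : Type*} [NormedAddCommGroup H] [InnerProductSpace ℂ H]
    (r : ℂ) (a : E →L[ℂ] E) (c : H →L[ℂ] H) :
    opTensor (r • a) c = r • opTensor a c := by
  ext z
  refine (HTensor.denseRange_emb E H).induction_on z
    (isClosed_eq (by fun_prop) (by fun_prop)) fun z => ?_
  rw [_root_.smul_apply, opTensor_emb, opTensor_emb, TensorProduct.mapL_smul_left,
    _root_.smul_apply, map_smul]

variable (n E) in
/-- The space `PH^∞_E(B_n)` of bounded free `k`-pluriharmonic functions. -/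
def boundedPluriharmonic : Submodule ℂ (PolyballFunction.{u} n E) where
  carrier := {F | IsFreePluriharmonic F ∧ IsBoundedFunction F}
  zero_mem' := by
    refine ⟨⟨0, fun H X => ?_⟩, fun H => ⟨0, fun X => ?_⟩⟩
    · have h : multiPart (E := E) (0 : Word n → Word n → (E →L[ℂ] E)) X.1 = fun _ => 0 := by
        funext m
        refine Finset.sum_eq_zero fun a _ => Finset.sum_eq_zero fun b _ => ?_
        simpa using opTensor_smul_left 0 (0 : E →L[ℂ] E)
          (monomial X.1 (fun i => List.ofFn (a i)) * star (monomial X.1 fun i => List.ofFn (b i)))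
      rw [h]
      exact HasIterSum.zero
    · simp
  add_mem' := by
    rintro F G ⟨⟨A, hA⟩, hF⟩ ⟨⟨B, hB⟩, hG⟩
    refine ⟨⟨A + B, fun H X => ?_⟩, fun H => ?_⟩
    · have h : multiPart (A + B) X.1 = fun m => multiPart A X.1 m + multiPart B X.1 m := by
        funext m
        simp only [multiPart, Pi.add_apply, opTensor_add_left, Finset.sum_add_distrib]
      rw [h]
      exact (hA H X).add (hB H X)
    · obtain ⟨C, hC⟩ := hF H
      obtain ⟨D, hD⟩ := hG H
      exact ⟨C + D, fun X => (norm_add_le (F H X).1 (G H X).1).trans (add_le_add (hC X) (hD X))⟩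
  smul_mem' := by
    rintro c F ⟨⟨A, hA⟩, hF⟩
    refine ⟨⟨c • A, fun H X => ?_⟩, fun H => ?_⟩
    · have h : multiPart (c • A) X.1 = fun m => c • multiPart A X.1 m := by
        funext m
        simp only [multiPart, Pi.smul_apply, opTensor_smul_left, Finset.smul_sum]
      rw [h]
      exact (hA H X).smul c
    · obtain ⟨C, hC⟩ := hF H
      refine ⟨‖c‖ * C, fun X => ?_⟩
      refine (norm_smul c (F H X).1).trans_le ?_
      exact mul_le_mul_of_nonneg_left (hC X) (norm_nonneg c)

/-- `A = SOT-lim_{r → 1} F(rS)`. -/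
def IsBoundaryLimit (F : PolyballFunction.{u} n E)
    (A : HTensor E (Fock.{u} n) →L[ℂ] HTensor E (Fock.{u} n)) : Prop :=
  ∀ x, Tendsto (fun r : Set.Ico (0 : ℝ) 1 =>
      (F ⟨Fock.{u} n⟩ ⟨scaledModel n r.1, scaledModel_mem_polyball n r.1 r.2⟩).1 x)
    (comap Subtype.val (𝓝 (1 : ℝ))) (𝓝 (A x))

/-- The operator on the `m`-fold Hilbert direct sum of `K` which is given by an `m × m` matrix of
operators on `K`. -/
noncomputable def matrixOp {K : Type*} [NormedAddCommGroup K] [InnerProductSpace ℂ K] {m : ℕ}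
    (M : Matrix (Fin m) (Fin m) (K →L[ℂ] K)) :
    PiLp 2 (fun _ : Fin m => K) →L[ℂ] PiLp 2 (fun _ : Fin m => K) :=
  ((PiLp.continuousLinearEquiv 2 ℂ fun _ : Fin m => K).symm : _ →L[ℂ] _) ∘L
    ContinuousLinearMap.pi fun i => ∑ j, M i j ∘L PiLp.proj 2 (fun _ : Fin m => K) j

end Pluriharmonic

end Polyball

open Polyball

/-!
The passage between functions and operators is governed by matrix entries. An operator `A` on
`E ⊗ F` has entries `A_{(α;β)} ∈ B(E)` (`entry`), and `A` is multi-Toeplitz exactly when a common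
suffix of `α_i` and `β_i` may be cancelled and all other suffixes of equal length give `0`
(`mem_multiToeplitz_iff`, `IsToeplitzMatrix.wordMul`). So `A` is determined by its entries at the
positions where, for every `i`, one of `α_i` and `β_i` is empty; these are the coefficients of a
free pluriharmonic series.

*From operators to functions.* The maps `Φ_{X_i}` are commuting strict contractions of `B(H)`, so
`Σ_t Φ_X^t(Δ_X(I)) = I` in norm (`hasSum_cpPow_defect`). This makes the Berezin kernel an isometry,
and its part of multi-length `p` decays geometrically in `p`. Expanding both kernels in
`B_X[A] = (I ⊗ K_X^*)(A ⊗ I)(I ⊗ K_X)` gives an absolutely convergent sum of the terms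
`A_{(β;α)} ⊗ X_β Δ_X(I) X_α^*` for any bounded `A` (`hasSum_berezinExt`). If `A` is multi-Toeplitz,
the terms of multidegree `m` are summed over their common suffixes by means of
`Σ_t Φ_X^t(Δ_X(I)) = I`, and what is left is the part of multidegree `m` of the pluriharmonic series
with the coefficients of `A` (`hasSum_multiPart`). Absolute convergence over `ℤ^k` implies the
iterated convergence in the definition of a free pluriharmonic function.

*Radial limits.* The value at `r S` of a pluriharmonic series has the entry
`r^{Σ|m_i|} A_{(α;β)}` at a position of multidegree `m` (`entry_of_hasIterSum`). By Parseval's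
identity and dominated convergence, `B_{rS}[A] → A` strongly for a multi-Toeplitz operator `A`
(`tendsto_berezinExt_scaledModel`).

*From functions to operators.* If `F` is bounded, the operators `F(rS)` have a weak limit along an
ultrafilter finer than `r → 1`. Its entries are the limits of those of `F(rS)`, hence it is
multi-Toeplitz with the coefficients of `F`, and its Berezin transform has the same series as `F`
(`exists_multiToeplitz`).

*Uniqueness and norms.* An isometry of the Fock space into an infinite dimensional `H` carries `r S`
to a point of the polyball of `H`, and the Berezin transform at `r S` is a compression of the one
at that point (`berezinExt_transport`); so the values on the polyball of `H` determine the operator.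
The Berezin transform is completely contractive since the kernel is an isometry, and strong
convergence at `r S` gives the reverse inequality (`isLUB_norm_matrixOp_berezinExt`).
-/

namespace Polyball

/-! ### The Hilbert tensor product -/

section HilbertTensor

variable {E H E' H' E'' H'' G : Type*}
  [NormedAddCommGroup E] [InnerProductSpace ℂ E] [NormedAddCommGroup H] [InnerProductSpace ℂ H]
  [NormedAddCommGroup E'] [InnerProductSpace ℂ E'] [NormedAddCommGroup H'] [InnerProductSpace ℂ H']
  [NormedAddCommGroup E''] [InnerProductSpace ℂ E'']
  [NormedAddCommGroup H''] [InnerProductSpace ℂ H'']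
  [NormedAddCommGroup G] [InnerProductSpace ℂ G]

/-- A closed property that is stable under sums holds on the Hilbert tensor product as soon as it
holds for the elementary tensors. -/
theorem htensor_induction {p : HTensor E H → Prop} (hc : IsClosed {z | p z}) (h0 : p 0)
    (hadd : ∀ z w, p z → p w → p (z + w)) (ht : ∀ x y, p (tmul x y)) (z : HTensor E H) : p z := by
  refine (HTensor.denseRange_emb E H).induction_on z hc fun w => ?_
  induction w using TensorProduct.induction_on with
  | zero => simpa using h0
  | tmul x y => exact ht x y
  | add a b ha hb => simpa using hadd _ _ ha hb

theorem htensor_op_ext {V : Type*} [NormedAddCommGroup V] [NormedSpace ℂ V]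
    {S T : HTensor E H →L[ℂ] V} (h : ∀ x y, S (tmul x y) = T (tmul x y)) : S = T := by
  ext z
  refine htensor_induction (p := fun z => S z = T z) (isClosed_eq (by fun_prop) (by fun_prop))
    (by simp) (fun z w hz hw => by simp [hz, hw]) h z

theorem htensor_ext_inner {z w : HTensor E H}
    (h : ∀ x y, inner ℂ (tmul x y) z = inner ℂ (tmul x y) w) : z = w := by
  refine ext_inner_left ℂ fun v => ?_
  refine htensor_induction (p := fun v => inner ℂ v z = inner ℂ v w)
    (isClosed_eq (by fun_prop) (by fun_prop)) (by simp)
    (fun a b ha hb => by rw [inner_add_left, inner_add_left, ha, hb]) h v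

theorem norm_tmul (x : E) (y : H) : ‖tmul x y‖ = ‖x‖ * ‖y‖ := by simp [tmul]

/-- The operator `y ↦ x ⊗ y`. -/
noncomputable def tensorLeft (x : E) : H →L[ℂ] HTensor E H :=
  (HTensor.emb E H).toContinuousLinearMap ∘L TensorProduct.mkL ℂ E H x

/-- The operator `x ↦ x ⊗ y`. -/
noncomputable def tensorRight (y : H) : E →L[ℂ] HTensor E H :=
  (HTensor.emb E H).toContinuousLinearMap ∘L (TensorProduct.mkL ℂ E H).flip y

@[simp] theorem tensorLeft_apply (x : E) (y : H) : tensorLeft x y = tmul x y := rfl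

@[simp] theorem tensorRight_apply (x : E) (y : H) : tensorRight y x = tmul x y := rfl

theorem tmul_add (x : E) (y z : H) : tmul x (y + z) = tmul x y + tmul x z :=
  map_add (tensorLeft x) y z

theorem add_tmul (x y : E) (z : H) : tmul (x + y) z = tmul x z + tmul y z :=
  map_add (tensorRight z) x y

theorem tmul_smul (c : ℂ) (x : E) (y : H) : tmul x (c • y) = c • tmul x y :=
  map_smul (tensorLeft x) c y

theorem smul_tmul (c : ℂ) (x : E) (y : H) : tmul (c • x) y = c • tmul x y :=
  map_smul (tensorRight y) c x

theorem norm_opTensor_le (a : E →L[ℂ] E') (b : H →L[ℂ] H') : ‖opTensor a b‖ ≤ ‖a‖ * ‖b‖ := by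
  refine ContinuousLinearMap.opNorm_le_bound _ (by positivity) fun z => ?_
  refine (HTensor.denseRange_emb E H).induction_on z
    (isClosed_le (by fun_prop) (by fun_prop)) fun w => ?_
  rw [opTensor_emb, LinearIsometry.norm_map, LinearIsometry.norm_map]
  exact (ContinuousLinearMap.le_opNorm _ _).trans
    (mul_le_mul_of_nonneg_right (TensorProduct.norm_mapL_le a b) (norm_nonneg _))

theorem norm_opTensor_id_le (b : H →L[ℂ] H') : ‖opTensor (ContinuousLinearMap.id ℂ E) b‖ ≤ ‖b‖ :=
  (norm_opTensor_le _ _).trans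
    (mul_le_of_le_one_left (norm_nonneg _) ContinuousLinearMap.norm_id_le)

theorem norm_opTensor_id_right_le (a : E →L[ℂ] E') :
    ‖opTensor a (ContinuousLinearMap.id ℂ H)‖ ≤ ‖a‖ :=
  (norm_opTensor_le _ _).trans
    (mul_le_of_le_one_right (norm_nonneg _) ContinuousLinearMap.norm_id_le)

theorem opTensor_comp (a : E' →L[ℂ] E'') (b : H' →L[ℂ] H'') (c : E →L[ℂ] E') (d : H →L[ℂ] H') :
    opTensor a b ∘L opTensor c d = opTensor (a ∘L c) (b ∘L d) :=
  htensor_op_ext fun x y => by simp [opTensor_tmul]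

@[simp] theorem opTensor_id :
    opTensor (ContinuousLinearMap.id ℂ E) (ContinuousLinearMap.id ℂ H) =
      ContinuousLinearMap.id ℂ (HTensor E H) :=
  htensor_op_ext fun x y => by simp [opTensor_tmul]

/-- The tensor product of two operators, as a bounded bilinear map. -/
noncomputable def opTensorL : (E →L[ℂ] E') →L[ℂ] (H →L[ℂ] H') →L[ℂ]
    (HTensor E H →L[ℂ] HTensor E' H') :=
  LinearMap.mkContinuous₂
    (LinearMap.mk₂ ℂ opTensor
      (fun a b c => htensor_op_ext fun x y => by simp [opTensor_tmul, add_tmul])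
      (fun r a c => htensor_op_ext fun x y => by simp [opTensor_tmul, smul_tmul])
      (fun a b c => htensor_op_ext fun x y => by simp [opTensor_tmul, tmul_add])
      (fun r a c => htensor_op_ext fun x y => by simp [opTensor_tmul, tmul_smul]))
    1 (fun a b => by simpa using norm_opTensor_le a b)

theorem opTensorL_apply (a : E →L[ℂ] E') (b : H →L[ℂ] H') : opTensorL a b = opTensor a b := rfl

theorem opTensor_sum_right {ι : Type*} (s : Finset ι) (a : E →L[ℂ] E') (f : ι → H →L[ℂ] H') :
    opTensor a (∑ i ∈ s, f i) = ∑ i ∈ s, opTensor a (f i) :=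
  map_sum (opTensorL a) f s

theorem opTensor_sum_left {ι : Type*} (s : Finset ι) (f : ι → E →L[ℂ] E') (b : H →L[ℂ] H') :
    opTensor (∑ i ∈ s, f i) b = ∑ i ∈ s, opTensor (f i) b := by
  rw [← opTensorL_apply, map_sum, _root_.sum_apply]
  rfl

@[simp] theorem opTensor_zero_left (b : H →L[ℂ] H') : opTensor (0 : E →L[ℂ] E') b = 0 :=
  (opTensorL.map_zero₂ b : _)

theorem opTensor_adjoint [CompleteSpace E] [CompleteSpace H] [CompleteSpace E'] [CompleteSpace H']
    (a : E →L[ℂ] E') (b : H →L[ℂ] H') :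
    ContinuousLinearMap.adjoint (opTensor a b) =
      opTensor (ContinuousLinearMap.adjoint a) (ContinuousLinearMap.adjoint b) := by
  refine htensor_op_ext fun x y => htensor_ext_inner fun x' y' => ?_
  simp only [ContinuousLinearMap.adjoint_inner_right, opTensor_tmul, inner_tmul]

theorem adjoint_tensorLeft_tmul [CompleteSpace H] (x x' : E) (y : H) :
    ContinuousLinearMap.adjoint (tensorLeft (H := H) x) (tmul x' y) = inner ℂ x x' • y := by
  refine ext_inner_left ℂ fun v => ?_
  rw [ContinuousLinearMap.adjoint_inner_right, tensorLeft_apply, inner_tmul, inner_smul_right]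

theorem adjoint_tensorRight_tmul [CompleteSpace E] (x : E) (y y' : H) :
    ContinuousLinearMap.adjoint (tensorRight (E := E) y) (tmul x y') = inner ℂ y y' • x := by
  refine ext_inner_left ℂ fun v => ?_
  rw [ContinuousLinearMap.adjoint_inner_right, tensorRight_apply, inner_tmul, inner_smul_right,
    mul_comm]

theorem assoc_symm_tmul (x : E) (y : H) (z : G) :
    (assoc E H G).symm (tmul x (tmul y z)) = tmul (tmul x y) z := by
  rw [← assoc_tmul, LinearIsometryEquiv.symm_apply_apply]

theorem opTensor_mem_minTensor (a : E →L[ℂ] E) (b : H →L[ℂ] H) : opTensor a b ∈ minTensor E H :=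
  Submodule.le_topologicalClosure _ (Submodule.subset_span ⟨a, b, rfl⟩)

end HilbertTensor

/-! ### Powers of the maps `Φ_{X_i}` and the defect operator -/

section OrderedProducts

variable {R : Type*} [NormedRing R]

/-- An ordered product of absolutely convergent series is the sum of the ordered products of their
terms. -/
theorem hasSum_ofFn_prod [CompleteSpace R] : ∀ {k : ℕ} (f : Fin k → ℕ → R) (s : Fin k → R),
    (∀ i, Summable fun p => ‖f i p‖) → (∀ i, HasSum (f i) (s i)) →
    (Summable fun t : Fin k → ℕ => ‖(List.ofFn fun i => f i (t i)).prod‖) ∧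
      HasSum (fun t : Fin k → ℕ => (List.ofFn fun i => f i (t i)).prod) (List.ofFn s).prod
  | 0, f, s, _, _ => by
      refine ⟨Summable.of_finite, ?_⟩
      simp
  | k + 1, f, s, hf, hs => by
      obtain ⟨h1, h2⟩ := hasSum_ofFn_prod (fun i => f i.succ) (fun i => s i.succ)
        (fun i => hf i.succ) (fun i => hs i.succ)
      set g : (Fin k → ℕ) → R := fun t => (List.ofFn fun i => f i.succ (t i)).prod with hg
      let e : ℕ × (Fin k → ℕ) ≃ (Fin (k + 1) → ℕ) := Fin.consEquiv fun _ => ℕ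
      have he : ∀ x, (List.ofFn fun i => f i (e x i)).prod = f 0 x.1 * g x.2 := fun x => by
        simp [e, hg, Fin.consEquiv, List.ofFn_succ]
      have h3 : Summable fun x : ℕ × (Fin k → ℕ) => ‖f 0 x.1 * g x.2‖ := (hf 0).mul_norm h1
      have h4 : HasSum (fun x : ℕ × (Fin k → ℕ) => f 0 x.1 * g x.2)
          (s 0 * (List.ofFn fun i => s i.succ).prod) := (hs 0).mul h2 h3.of_norm
      rw [← e.summable_iff, ← e.hasSum_iff, List.ofFn_succ, List.prod_cons]
      simp only [Function.comp_def, he]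
      exact ⟨h3, h4⟩

theorem ofFn_prod_mul {R : Type*} [Monoid R] : ∀ {k : ℕ} (G D : Fin k → R),
    (∀ i j, i ≠ j → Commute (G i) (D j)) →
    (List.ofFn fun i => G i * D i).prod = (List.ofFn G).prod * (List.ofFn D).prod
  | 0, _, _, _ => by simp
  | k + 1, G, D, h => by
      have hc : Commute (List.ofFn fun i : Fin k => G i.succ).prod (D 0) := by
        refine Commute.list_prod_left _ _ fun x hx => ?_
        obtain ⟨i, rfl⟩ := (List.mem_ofFn' _ _).1 hx
        exact h _ _ (Fin.succ_ne_zero i)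
      simp only [List.ofFn_succ, List.prod_cons]
      rw [ofFn_prod_mul (fun i => G i.succ) (fun i => D i.succ)
          (fun i j hij => h _ _ fun h => hij (Fin.succ_injective _ h)),
        mul_assoc, mul_assoc, ← mul_assoc (D 0), ← hc.eq, mul_assoc]

end OrderedProducts

section CpMap

variable {H : Type*} [NormedAddCommGroup H] [InnerProductSpace ℂ H] [CompleteSpace H]

theorem cpMap_apply {m : ℕ} (T : Fin m → (H →L[ℂ] H)) (Y : H →L[ℂ] H) :
    cpMap T Y = ∑ j, T j * Y * star (T j) := rfl

theorem norm_cpMap_le {m : ℕ} (T : Fin m → (H →L[ℂ] H)) (Y : H →L[ℂ] H) :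
    ‖cpMap T Y‖ ≤ ‖∑ j, T j * star (T j)‖ * ‖Y‖ := by
  set ρ := ‖∑ j, T j * star (T j)‖
  have key : ∀ h, ∑ j, ‖star (T j) h‖ ^ 2 ≤ ρ * ‖h‖ ^ 2 := fun h => by
    have := sum_words_length T 1 h
    rw [← (Equiv.funUnique (Fin 1) (Fin m)).symm.sum_comp] at this
    simpa [wordProd] using this
  refine ContinuousLinearMap.opNorm_le_of_re_inner_le (by positivity) fun x y hx hy => ?_
  have hj : ∀ j, RCLike.re (inner ℂ ((T j * Y * star (T j)) x) y) ≤
      ‖Y‖ * ((‖star (T j) x‖ ^ 2 + ‖star (T j) y‖ ^ 2) / 2) := fun j => by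
    have h1 : inner ℂ ((T j * Y * star (T j)) x) y =
        inner ℂ (Y (star (T j) x)) (star (T j) y) := by
      rw [mul_apply_eq_comp, mul_apply_eq_comp, ContinuousLinearMap.star_eq_adjoint,
        ContinuousLinearMap.adjoint_inner_right]
    rw [h1]
    calc _ ≤ ‖Y (star (T j) x)‖ * ‖star (T j) y‖ := re_inner_le_norm _ _
      _ ≤ ‖Y‖ * ‖star (T j) x‖ * ‖star (T j) y‖ := by gcongr; exact Y.le_opNorm _
      _ = ‖Y‖ * (‖star (T j) x‖ * ‖star (T j) y‖) := by ring
      _ ≤ _ := by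
        gcongr
        -- The inequality between the arithmetic and the geometric mean replaces Cauchy-Schwarz.
        nlinarith [sq_nonneg (‖star (T j) x‖ - ‖star (T j) y‖)]
  rw [cpMap_apply, _root_.sum_apply, sum_inner, map_sum]
  refine (Finset.sum_le_sum fun j _ => hj j).trans ?_
  rw [← Finset.mul_sum, ← Finset.sum_div, Finset.sum_add_distrib, mul_comm ρ]
  have hx' := key x
  have hy' := key y
  rw [hx] at hx'
  rw [hy] at hy'
  gcongr
  linarith

/-- The map `Φ_T` as a bounded operator on the Banach space of bounded operators. -/
noncomputable def cpMapL {m : ℕ} (T : Fin m → (H →L[ℂ] H)) : (H →L[ℂ] H) →L[ℂ] (H →L[ℂ] H) :=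
  (cpMap T).mkContinuous ‖∑ j, T j * star (T j)‖ (norm_cpMap_le T)

theorem cpMapL_apply {m : ℕ} (T : Fin m → (H →L[ℂ] H)) (Y : H →L[ℂ] H) :
    cpMapL T Y = ∑ j, T j * Y * star (T j) := rfl

theorem norm_cpMapL_le {m : ℕ} (T : Fin m → (H →L[ℂ] H)) :
    ‖cpMapL T‖ ≤ ‖∑ j, T j * star (T j)‖ :=
  LinearMap.mkContinuous_norm_le _ (norm_nonneg _) _

theorem cpMapL_pow_apply {m : ℕ} (T : Fin m → (H →L[ℂ] H)) (p : ℕ) (Y : H →L[ℂ] H) :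
    (cpMapL T ^ p) Y =
      ∑ a : Fin p → Fin m, wordProd T (List.ofFn a) * Y * star (wordProd T (List.ofFn a)) := by
  induction p with
  | zero => simp [wordProd]
  | succ p ih =>
    rw [pow_succ', mul_apply_eq_comp, ih, cpMapL_apply,
      ← (Fin.consEquiv fun _ => Fin m).sum_comp, Fintype.sum_prod_type]
    refine Finset.sum_congr rfl fun j _ => ?_
    rw [Finset.mul_sum, Finset.sum_mul]
    refine Finset.sum_congr rfl fun a _ => ?_
    simp [Fin.consEquiv, wordProd, List.ofFn_succ, star_mul, mul_assoc]

variable {k : ℕ}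

/-- The composition `Φ_{X_1}^{t_1} ∘ ⋯ ∘ Φ_{X_k}^{t_k}`. -/
noncomputable def cpPow {n : Fin k → ℕ} (X : Tuple n H) (t : Fin k → ℕ) :
    (H →L[ℂ] H) →L[ℂ] (H →L[ℂ] H) :=
  (List.ofFn fun i => cpMapL (X i) ^ t i).prod

/-- The ordered composition of powers of the `Φ_{X_i}` is a sum over all tuples of words of
multi-length `t`. -/
theorem cpPow_apply : ∀ {k : ℕ} {n : Fin k → ℕ} (X : Tuple n H) (t : Fin k → ℕ) (Y : H →L[ℂ] H),
    cpPow X t Y = ∑ a : ∀ i, Fin (t i) → Fin (n i),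
      monomial X (fun i => List.ofFn (a i)) * Y * star (monomial X fun i => List.ofFn (a i))
  | 0, n, X, t, Y => by simp [cpPow, monomial]
  | k + 1, n, X, t, Y => by
      have ih := cpPow_apply (fun i => X i.succ) (fun i => t i.succ) Y
      rw [cpPow] at ih
      rw [cpPow, List.ofFn_succ, List.prod_cons, mul_apply_eq_comp, ih, cpMapL_pow_apply,
        ← (Fin.consEquiv fun i => Fin (t i) → Fin (n i)).sum_comp, Fintype.sum_prod_type]
      refine Finset.sum_congr rfl fun j _ => ?_
      rw [Finset.mul_sum, Finset.sum_mul]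
      refine Finset.sum_congr rfl fun a _ => ?_
      simp [Fin.consEquiv, monomial, List.ofFn_succ, star_mul, mul_assoc]

theorem commute_cpMapL {l m : ℕ} {S : Fin l → (H →L[ℂ] H)} {T : Fin m → (H →L[ℂ] H)}
    (h : ∀ p q, S p * T q = T q * S p) : Commute (cpMapL S) (cpMapL T) := by
  ext1 Y
  simp only [mul_apply_eq_comp, cpMapL_apply, Finset.mul_sum, Finset.sum_mul]
  rw [Finset.sum_comm]
  refine Finset.sum_congr rfl fun q _ => Finset.sum_congr rfl fun p _ => ?_
  calc _ = (S p * T q) * Y * star (S p * T q) := by rw [star_mul]; simp only [mul_assoc]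
    _ = _ := by rw [h, star_mul]; simp only [mul_assoc]

theorem defect_eq {n : Fin k → ℕ} (X : Tuple n H) :
    defect X = (List.ofFn fun i => 1 - cpMapL (X i)).prod 1 := by
  rw [defect, List.ofFn_eq_map, List.ofFn_eq_map]
  generalize List.finRange k = l
  suffices h : ∀ Y, ((l.map fun i => 1 - cpMap (X i)).prod : Module.End ℂ (H →L[ℂ] H)) Y =
      (l.map fun i => 1 - cpMapL (X i)).prod Y from h 1
  intro Y
  induction l with
  | nil => rfl
  | cons i l ih =>
    rw [List.map_cons, List.prod_cons, List.map_cons, List.prod_cons, Module.End.mul_apply, ih]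
    rfl

/-- The maps `Φ_{X_i}` are commuting strict contractions, so that `Δ_X` is inverted by the product
of their geometric series. -/
theorem hasSum_cpPow_defect {n : Fin k → ℕ} (X : polyball n H) :
    (Summable fun t => ‖cpPow X.1 t‖) ∧ HasSum (fun t => cpPow X.1 t (defect X.1)) 1 := by
  have hlt : ∀ i, ‖cpMapL (X.1 i)‖ < 1 := fun i => (norm_cpMapL_le _).trans_lt (X.2.2.1 i)
  obtain ⟨h1, h2⟩ := hasSum_ofFn_prod (fun i p => cpMapL (X.1 i) ^ p)
    (fun i => ∑' p, cpMapL (X.1 i) ^ p)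
    (fun i => summable_norm_geometric_of_norm_lt_one (hlt i))
    (fun i => (summable_geometric_of_norm_lt_one (hlt i)).hasSum)
  refine ⟨h1, ?_⟩
  have h3 := h2.mapL (ContinuousLinearMap.apply ℂ (H →L[ℂ] H) (defect X.1))
  simp only [ContinuousLinearMap.apply_apply] at h3
  refine (congrArg (HasSum fun t => cpPow X.1 t (defect X.1)) ?_).mp h3
  rw [defect_eq, ← mul_apply_eq_comp, ← ofFn_prod_mul]
  · simp only [geom_series_mul_neg _ (hlt _)]
    simp
  · intro i j hij
    -- The inverse of `1 - Φ_{X_i}` commutes with everything that `1 - Φ_{X_i}` commutes with.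
    have hc : Commute (1 - cpMapL (X.1 j)) (1 - cpMapL (X.1 i)) :=
      ((Commute.one_left _).sub_left
        ((Commute.one_right _).sub_right (commute_cpMapL fun p q => X.2.1 j i hij.symm p q)))
    set G := ∑' p, cpMapL (X.1 i) ^ p
    have hG1 : G * (1 - cpMapL (X.1 i)) = 1 := geom_series_mul_neg _ (hlt i)
    have hG2 : (1 - cpMapL (X.1 i)) * G = 1 := mul_neg_geom_series _ (hlt i)
    calc G * (1 - cpMapL (X.1 j)) =
          G * ((1 - cpMapL (X.1 j)) * (1 - cpMapL (X.1 i))) * G := by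
          rw [mul_assoc, mul_assoc, hG2, mul_one]
      _ = (1 - cpMapL (X.1 j)) * G := by rw [hc.eq, ← mul_assoc, hG1, one_mul]

end CpMap

/-! ### The homogeneous parts of the Berezin kernel -/

section Words

variable {k : ℕ} {n : Fin k → ℕ}

/-- The tuples of words whose `i`-th word has length `p i`, with every word given by its letters. -/
abbrev FinWord (n : Fin k → ℕ) (p : Fin k → ℕ) : Type := ∀ i, Fin (p i) → Fin (n i)

/-- A tuple of words of prescribed lengths, as a tuple of lists. -/
abbrev FinWord.toWord {p : Fin k → ℕ} (a : FinWord n p) : Word n := fun i => List.ofFn (a i)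

theorem FinWord.length_toWord {p : Fin k → ℕ} (a : FinWord n p) (i : Fin k) :
    (a.toWord i).length = p i := List.length_ofFn

theorem FinWord.toWord_injective {p : Fin k → ℕ} :
    Function.Injective (FinWord.toWord : FinWord n p → Word n) :=
  fun _ _ h => funext fun i => List.ofFn_injective (congrFun h i)

theorem FinWord.exists_toWord {p : Fin k → ℕ} {α : Word n} (h : ∀ i, (α i).length = p i) :
    ∃ a : FinWord n p, a.toWord = α := by
  obtain rfl : (fun i => (α i).length) = p := funext h
  exact ⟨fun i => (α i).get, funext fun i => List.ofFn_get _⟩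

/-- Sorting tuples of words by their multi-length. -/
noncomputable def wordEquiv (n : Fin k → ℕ) : (Σ p : Fin k → ℕ, FinWord n p) ≃ Word n :=
  Equiv.ofBijective (fun x => x.2.toWord) ⟨by
    rintro ⟨p, a⟩ ⟨q, b⟩ h
    obtain rfl : p = q := funext fun i => by
      rw [← a.length_toWord i, ← b.length_toWord i]
      exact congrArg _ (congrFun h i)
    exact congrArg _ (FinWord.toWord_injective h), fun α => by
    obtain ⟨a, ha⟩ := FinWord.exists_toWord (α := α) fun _ => rfl
    exact ⟨⟨_, a⟩, ha⟩⟩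

end Words

section Kernel

variable {k : ℕ} {n : Fin k → ℕ} {H : Type u} [NormedAddCommGroup H] [InnerProductSpace ℂ H]
  [CompleteSpace H]

theorem star_kernelCoeff_mul (X : polyball n H) (α β : Word n) :
    star (kernelCoeff X.1 α) * kernelCoeff X.1 β =
      monomial X.1 α * defect X.1 * star (monomial X.1 β) := by
  have h0 : 0 ≤ defect X.1 := X.2.2.2.nonneg
  rw [kernelCoeff, kernelCoeff, star_mul, star_star,
    (CFC.sqrt_nonneg (defect X.1)).isSelfAdjoint.star_eq,
    mul_assoc, ← mul_assoc (CFC.sqrt _), CFC.sqrt_mul_sqrt_self _ h0, mul_assoc]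

/-- The part of the Berezin kernel with values in `F_p ⊗ H`, where `F_p` is spanned by the `e_α`
with `|α_i| = p_i`. -/
noncomputable def kernelPart (X : Tuple n H) (p : Fin k → ℕ) : H →L[ℂ] HTensor (Fock.{u} n) H :=
  ∑ a : FinWord n p, tensorLeft (fockBasis a.toWord) ∘L kernelCoeff X a.toWord

theorem kernelPart_apply (X : Tuple n H) (p : Fin k → ℕ) (h : H) :
    kernelPart.{u} X p h =
      ∑ a : FinWord n p, tmul (fockBasis a.toWord) (kernelCoeff X a.toWord h) := by
  simp [kernelPart, _root_.sum_apply]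

/-- The homogeneous parts of the Berezin kernel have orthogonal ranges. -/
theorem adjoint_kernelPart_comp (X : polyball n H) (q p : Fin k → ℕ) :
    ContinuousLinearMap.adjoint (kernelPart.{u} X.1 q) ∘L kernelPart.{u} X.1 p =
      if q = p then cpPow X.1 p (defect X.1) else 0 := by
  ext h
  simp only [kernelPart, map_sum, ContinuousLinearMap.adjoint_comp, ContinuousLinearMap.comp_apply,
    _root_.sum_apply, adjoint_tensorLeft_tmul, tensorLeft_apply, inner_fockBasis, map_smul]
  split_ifs with hqp
  · subst hqp
    simp only [cpPow_apply, _root_.sum_apply, FinWord.toWord_injective.eq_iff]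
    refine Finset.sum_congr rfl fun a _ => ?_
    rw [Finset.sum_eq_single a (fun b _ hb => by rw [if_neg hb, zero_smul]) (by simp),
      if_pos rfl, one_smul, ← star_kernelCoeff_mul]
    rfl
  · refine Finset.sum_eq_zero fun a _ => Finset.sum_eq_zero fun b _ => ?_
    rw [if_neg, zero_smul]
    exact fun h => hqp (funext fun i => by
      rw [← a.length_toWord i, ← b.length_toWord i, h])

theorem norm_cpPow_le (X : Tuple n H) (t : Fin k → ℕ) :
    ‖cpPow X t‖ ≤ (List.ofFn fun i => ‖∑ j, X i j * star (X i j)‖ ^ t i).prod := by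
  rw [cpPow, List.ofFn_eq_map, List.ofFn_eq_map]
  induction List.finRange k with
  | nil => exact ContinuousLinearMap.norm_id_le
  | cons i l ih =>
    rw [List.map_cons, List.prod_cons, List.map_cons, List.prod_cons]
    refine (norm_mul_le _ _).trans (mul_le_mul ?_ ih (norm_nonneg _) (by positivity))
    -- The exponent `0` is separate because `‖1‖ = 1` fails when `H` is trivial.
    rcases Nat.eq_zero_or_pos (t i) with h | h
    · rw [h, pow_zero, pow_zero]
      exact ContinuousLinearMap.norm_id_le
    · exact (norm_pow_le' _ h).trans (pow_le_pow_left₀ (norm_nonneg _) (norm_cpMapL_le _) _)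

/-- The homogeneous parts of the Berezin kernel decay geometrically, because
`‖K_p‖ ^ 2 = ‖Φ_X^p(Δ_X(I))‖`. -/
theorem summable_norm_kernelPart (X : polyball n H) :
    Summable fun p => ‖kernelPart.{u} X.1 p‖ := by
  set ρ : Fin k → ℝ := fun i => ‖∑ j, X.1 i j * star (X.1 i j)‖ with hρ
  have hρ1 : ∀ i, ‖Real.sqrt (ρ i)‖ < 1 := fun i => by
    rw [Real.norm_of_nonneg (Real.sqrt_nonneg _), Real.sqrt_lt' one_pos, one_pow]
    exact X.2.2.1 i
  have hs := (hasSum_ofFn_prod (fun i p => Real.sqrt (ρ i) ^ p)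
    (fun i => ∑' p, Real.sqrt (ρ i) ^ p)
    (fun i => summable_norm_geometric_of_norm_lt_one (hρ1 i))
    (fun i => (summable_geometric_of_norm_lt_one (hρ1 i)).hasSum)).1
  refine Summable.of_nonneg_of_le (fun _ => norm_nonneg _) (fun p => ?_)
    (hs.mul_right (Real.sqrt ‖defect X.1‖))
  refine (pow_le_pow_iff_left₀ (norm_nonneg _) (by positivity) two_ne_zero).1 ?_
  have h1 : ‖kernelPart.{u} X.1 p‖ ^ 2 = ‖cpPow X.1 p (defect X.1)‖ := by
    have := adjoint_kernelPart_comp X p p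
    rw [if_pos rfl] at this
    rw [← this, ContinuousLinearMap.norm_adjoint_comp_self, sq]
  have h2 : (List.ofFn fun i => Real.sqrt (ρ i) ^ p i).prod ^ 2 =
      (List.ofFn fun i => ρ i ^ p i).prod := by
    rw [List.prod_ofFn, List.prod_ofFn, ← Finset.prod_pow]
    refine Finset.prod_congr rfl fun i _ => ?_
    rw [← pow_mul, mul_comm, pow_mul, Real.sq_sqrt (norm_nonneg _)]
  rw [h1, mul_pow, Real.sq_sqrt (norm_nonneg _), Real.norm_eq_abs, sq_abs, h2]
  exact (ContinuousLinearMap.le_opNorm _ _).trans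
    (mul_le_mul_of_nonneg_right (norm_cpPow_le _ _) (norm_nonneg _))

theorem hasSum_kernelPart (X : polyball n H) :
    HasSum (kernelPart.{u} X.1) (berezinKernel X) := by
  have hs := (summable_norm_kernelPart X).of_norm.hasSum
  refine (congrArg (HasSum (kernelPart.{u} X.1)) ?_).mp hs
  ext1 h
  have h1 := hs.mapL (ContinuousLinearMap.apply ℂ (HTensor (Fock.{u} n) H) h)
  have h2 := (Equiv.ulift.{u}.symm.hasSum_iff.2 (hasSum_berezinKernel X h))
  have h3 := ((wordEquiv n).hasSum_iff.2 h2).sigma fun p => hasSum_fintype _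
  refine h1.unique (h3.congr_fun fun p => ?_)
  rw [ContinuousLinearMap.apply_apply, kernelPart_apply]
  rfl

theorem hasSum_adjoint_kernelPart (X : polyball n H) :
    HasSum (fun p => ContinuousLinearMap.adjoint (kernelPart.{u} X.1 p))
      (ContinuousLinearMap.adjoint (berezinKernel X)) :=
  (hasSum_kernelPart X).map (ContinuousLinearMap.adjoint (𝕜 := ℂ) (E := H))
    (ContinuousLinearMap.adjoint (𝕜 := ℂ) (E := H)).continuous

/-- The Berezin kernel is an isometry. -/
theorem adjoint_berezinKernel_comp (X : polyball n H) :
    ContinuousLinearMap.adjoint (berezinKernel X) ∘L berezinKernel X =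
      ContinuousLinearMap.id ℂ H := by
  have h1 := (hasSum_adjoint_kernelPart X).mapL
    ((ContinuousLinearMap.compL ℂ H (HTensor (Fock.{u} n) H) H).flip (berezinKernel X))
  refine h1.unique ((hasSum_cpPow_defect X).2.congr_fun fun q => ?_)
  have h2 := (hasSum_kernelPart X).mapL (ContinuousLinearMap.compL ℂ H (HTensor (Fock.{u} n) H) H
    (ContinuousLinearMap.adjoint (kernelPart.{u} X.1 q)))
  refine h2.unique ?_
  simp only [ContinuousLinearMap.compL_apply, adjoint_kernelPart_comp]
  convert hasSum_ite_eq q (cpPow X.1 q (defect X.1)) using 2 with p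
  by_cases hpq : q = p
  · simp [hpq]
  · rw [if_neg hpq, if_neg (Ne.symm hpq)]

end Kernel

/-! ### Matrix entries of operators on `E ⊗ F` -/

section Entries

variable {k : ℕ} {n : Fin k → ℕ} {E : Type v} [NormedAddCommGroup E] [InnerProductSpace ℂ E]

theorem htensor_fock_op_ext {V : Type*} [NormedAddCommGroup V] [NormedSpace ℂ V]
    {S T : HTensor E (Fock.{u} n) →L[ℂ] V}
    (h : ∀ α x, S (tmul x (fockBasis α)) = T (tmul x (fockBasis α))) : S = T := by
  refine htensor_op_ext fun x y => ?_
  have hS := (fock_hasSum y).mapL (S ∘L tensorLeft x)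
  have hT := (fock_hasSum y).mapL (T ∘L tensorLeft x)
  simp only [map_smul, ContinuousLinearMap.comp_apply, tensorLeft_apply, h] at hS hT
  exact hS.unique hT

variable [CompleteSpace E]

/-- The slice `z ↦ z_α` of `E ⊗ F` along the basis vector `e_α`. -/
noncomputable def slice (α : Word n) : HTensor E (Fock.{u} n) →L[ℂ] E :=
  ContinuousLinearMap.adjoint (tensorRight (fockBasis α))

theorem slice_tmul (α : Word n) (x : E) (y : Fock.{u} n) :
    slice α (tmul x y) = (inner ℂ (fockBasis α) y : ℂ) • x :=
  adjoint_tensorRight_tmul _ _ _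

theorem inner_slice (α : Word n) (x : E) (z : HTensor E (Fock.{u} n)) :
    inner ℂ x (slice α z) = inner ℂ (tmul x (fockBasis α)) z :=
  ContinuousLinearMap.adjoint_inner_right _ _ _

theorem ext_slice {z w : HTensor E (Fock.{u} n)} (h : ∀ α, slice α z = slice α w) : z = w := by
  have : innerSL ℂ z = innerSL ℂ w := htensor_fock_op_ext fun α x => by
    rw [innerSL_apply_apply, innerSL_apply_apply, ← inner_conj_symm, ← inner_slice, h, inner_slice,
      inner_conj_symm]
  exact innerSL_inj.1 this

/-- The matrix entries `A_{(α;β)} ∈ B(E)` of an operator `A` on `E ⊗ F`. -/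
noncomputable def entry (A : HTensor E (Fock.{u} n) →L[ℂ] HTensor E (Fock.{u} n))
    (α β : Word n) : E →L[ℂ] E :=
  slice α ∘L A ∘L tensorRight (fockBasis β)

theorem entry_apply (A : HTensor E (Fock.{u} n) →L[ℂ] HTensor E (Fock.{u} n)) (α β : Word n)
    (x : E) : entry A α β x = slice α (A (tmul x (fockBasis β))) := rfl

theorem ext_entry {A B : HTensor E (Fock.{u} n) →L[ℂ] HTensor E (Fock.{u} n)}
    (h : ∀ α β, entry A α β = entry B α β) : A = B :=
  htensor_fock_op_ext fun β x => ext_slice fun α => by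
    rw [← entry_apply, ← entry_apply, h]

/-- The passage to a matrix entry, as a bounded linear map. -/
noncomputable def entryL (α β : Word n) :
    (HTensor E (Fock.{u} n) →L[ℂ] HTensor E (Fock.{u} n)) →L[ℂ] (E →L[ℂ] E) :=
  ContinuousLinearMap.compL ℂ E (HTensor E (Fock.{u} n)) E (slice α) ∘L
    (ContinuousLinearMap.compL ℂ E (HTensor E (Fock.{u} n)) (HTensor E (Fock.{u} n))).flip
      (tensorRight (fockBasis β))

theorem entryL_apply (A : HTensor E (Fock.{u} n) →L[ℂ] HTensor E (Fock.{u} n)) (α β : Word n) :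
    entryL α β A = entry A α β := rfl

end Entries

/-! ### The expansion of the Berezin transform -/

section Expansion

variable {k : ℕ} {n : Fin k → ℕ} {E : Type v} [NormedAddCommGroup E] [InnerProductSpace ℂ E]
  {H : Type u} [NormedAddCommGroup H] [InnerProductSpace ℂ H]

/-- The operator `A ⊗ I_H`, acting on `E ⊗ (F ⊗ H)`. -/
noncomputable def ampliation (H : Type u) [NormedAddCommGroup H] [InnerProductSpace ℂ H]
    (A : HTensor E (Fock.{u} n) →L[ℂ] HTensor E (Fock.{u} n)) :
    HTensor E (HTensor (Fock.{u} n) H) →L[ℂ] HTensor E (HTensor (Fock.{u} n) H) :=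
  (assoc E (Fock.{u} n) H : _ →L[ℂ] HTensor E (HTensor (Fock.{u} n) H)) ∘L
    opTensor A (ContinuousLinearMap.id ℂ H) ∘L
    ((assoc E (Fock.{u} n) H).symm : _ →L[ℂ] HTensor (HTensor E (Fock.{u} n)) H)

theorem norm_ampliation_le (A : HTensor E (Fock.{u} n) →L[ℂ] HTensor E (Fock.{u} n)) :
    ‖ampliation H A‖ ≤ ‖A‖ := by
  refine ContinuousLinearMap.opNorm_le_bound _ (norm_nonneg _) fun z => ?_
  change ‖assoc E (Fock.{u} n) H (opTensor A _ ((assoc E (Fock.{u} n) H).symm z))‖ ≤ _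
  rw [LinearIsometryEquiv.norm_map]
  refine (ContinuousLinearMap.le_opNorm _ _).trans ?_
  rw [LinearIsometryEquiv.norm_map]
  gcongr
  exact norm_opTensor_id_right_le A

variable [CompleteSpace E] [CompleteSpace H]

theorem adjoint_kernelPart_tmul (X : Tuple n H) (q : Fin k → ℕ) (y : Fock.{u} n) (h : H) :
    ContinuousLinearMap.adjoint (kernelPart.{u} X q) (tmul y h) =
      ∑ b : FinWord n q, (inner ℂ (fockBasis b.toWord) y : ℂ) •
        star (kernelCoeff X b.toWord) h := by
  simp only [kernelPart, map_sum, ContinuousLinearMap.adjoint_comp, ContinuousLinearMap.comp_apply,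
    _root_.sum_apply, adjoint_tensorLeft_tmul, map_smul]
  rfl

theorem berezinExt_eq (X : polyball n H)
    (A : HTensor E (Fock.{u} n) →L[ℂ] HTensor E (Fock.{u} n)) :
    berezinExt X A = opTensor (ContinuousLinearMap.id ℂ E)
      (ContinuousLinearMap.adjoint (berezinKernel X)) ∘L ampliation H A ∘L
      opTensor (ContinuousLinearMap.id ℂ E) (berezinKernel X) := rfl

/-- Between two homogeneous parts of the Berezin kernel, the ampliation of `A` is seen only through
finitely many matrix entries of `A`. -/
theorem kernelPart_ampliation_kernelPart (X : Tuple n H) (q p : Fin k → ℕ)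
    (A : HTensor E (Fock.{u} n) →L[ℂ] HTensor E (Fock.{u} n)) :
    opTensor (ContinuousLinearMap.id ℂ E) (ContinuousLinearMap.adjoint (kernelPart.{u} X q)) ∘L
      ampliation H A ∘L opTensor (ContinuousLinearMap.id ℂ E) (kernelPart.{u} X p) =
    ∑ b : FinWord n q, ∑ a : FinWord n p, opTensor (entry A b.toWord a.toWord)
      (star (kernelCoeff X b.toWord) * kernelCoeff X a.toWord) := by
  -- For a fixed vector of `H`, both sides are operators in the vector of `E ⊗ F` on their left, and
  -- they may be compared on elementary tensors, which `A` does not preserve.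
  have key : ∀ h : H, opTensor (ContinuousLinearMap.id ℂ E)
      (ContinuousLinearMap.adjoint (kernelPart.{u} X q)) ∘L
      (assoc E (Fock.{u} n) H : _ →L[ℂ] HTensor E (HTensor (Fock.{u} n) H)) ∘L tensorRight h =
      ∑ b : FinWord n q, tensorRight (star (kernelCoeff X b.toWord) h) ∘L slice b.toWord := by
    intro h
    refine htensor_op_ext fun x y => ?_
    simp only [ContinuousLinearMap.comp_apply, tensorRight_apply, _root_.sum_apply, slice_tmul]
    change opTensor _ _ (assoc E (Fock.{u} n) H (tmul (tmul x y) h)) = _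
    rw [assoc_tmul, opTensor_tmul, adjoint_kernelPart_tmul]
    simp only [← tensorLeft_apply, map_sum, map_smul]
    simp [smul_tmul]
  refine htensor_op_ext fun x h => ?_
  simp only [ContinuousLinearMap.comp_apply, opTensor_tmul, kernelPart_apply, _root_.sum_apply,
    ContinuousLinearMap.coe_id', id_eq]
  simp only [← tensorLeft_apply x, map_sum]
  rw [Finset.sum_comm]
  refine Finset.sum_congr rfl fun a _ => ?_
  have h1 : ampliation H A (tmul x (tmul (fockBasis a.toWord) (kernelCoeff X a.toWord h))) =
      assoc E (Fock.{u} n) H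
        (tmul (A (tmul x (fockBasis a.toWord))) (kernelCoeff X a.toWord h)) := by
    change assoc E (Fock.{u} n) H (opTensor A _ ((assoc E (Fock.{u} n) H).symm _)) = _
    rw [assoc_symm_tmul, opTensor_tmul]
    rfl
  have h2 := congrArg (fun T => T (A (tmul x (fockBasis a.toWord))))
    (key (kernelCoeff X a.toWord h))
  simp only [_root_.sum_apply] at h2
  rw [tensorLeft_apply, h1]
  exact h2

theorem hasSum_comp_comp {ι V W V' W' : Type*} [NormedAddCommGroup V] [NormedSpace ℂ V]
    [NormedAddCommGroup W] [NormedSpace ℂ W] [NormedAddCommGroup V'] [NormedSpace ℂ V']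
    [NormedAddCommGroup W'] [NormedSpace ℂ W'] [CompleteSpace W']
    {g : ι → V' →L[ℂ] W'} {f : ι → V →L[ℂ] W} {G : V' →L[ℂ] W'} {F : V →L[ℂ] W}
    (M : W →L[ℂ] V') (hg : HasSum g G) (hf : HasSum f F) (hg' : Summable fun i => ‖g i‖)
    (hf' : Summable fun i => ‖f i‖) :
    HasSum (fun x : ι × ι => g x.1 ∘L M ∘L f x.2) (G ∘L M ∘L F) := by
  have hsum : Summable fun x : ι × ι => g x.1 ∘L M ∘L f x.2 := by
    have h1 := hg'.mul_of_nonneg hf' (fun _ => norm_nonneg _) (fun _ => norm_nonneg _)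
    refine Summable.of_norm_bounded (h1.mul_left ‖M‖) fun x => ?_
    calc _ ≤ ‖g x.1‖ * (‖M‖ * ‖f x.2‖) := (ContinuousLinearMap.opNorm_comp_le _ _).trans
            (mul_le_mul_of_nonneg_left (ContinuousLinearMap.opNorm_comp_le _ _) (norm_nonneg _))
      _ = _ := by ring
  have h1 : ∀ q, HasSum (fun p => g q ∘L M ∘L f p) (g q ∘L M ∘L F) := fun q =>
    hf.mapL (ContinuousLinearMap.compL ℂ V V' W' (g q) ∘L ContinuousLinearMap.compL ℂ V W V' M)
  have h2 : HasSum (fun q => g q ∘L M ∘L F) (G ∘L M ∘L F) :=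
    hg.mapL ((ContinuousLinearMap.compL ℂ V V' W').flip (M ∘L F))
  rw [h2.unique (hsum.hasSum.prod_fiberwise h1)]
  exact hsum.hasSum

/-- The Berezin transform of an arbitrary operator `A` is the norm-convergent sum of the terms
`A_{(β;α)} ⊗ X_β Δ_X(I) X_α^*`, grouped according to the lengths of `β` and `α`. -/
theorem hasSum_berezinExt (X : polyball n H)
    (A : HTensor E (Fock.{u} n) →L[ℂ] HTensor E (Fock.{u} n)) :
    HasSum (fun x : (Fin k → ℕ) × (Fin k → ℕ) => ∑ b : FinWord n x.1, ∑ a : FinWord n x.2,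
      opTensor (entry A b.toWord a.toWord)
        (monomial X.1 b.toWord * defect X.1 * star (monomial X.1 a.toWord))) (berezinExt X A) := by
  have h1 := (hasSum_kernelPart X).mapL (opTensorL (ContinuousLinearMap.id ℂ E))
  have h2 := (hasSum_adjoint_kernelPart X).mapL (opTensorL (ContinuousLinearMap.id ℂ E))
  have h3 := hasSum_comp_comp (ampliation H A) h2 h1
    (Summable.of_nonneg_of_le (fun _ => norm_nonneg _)
      (fun p => (norm_opTensor_id_le _).trans_eq (LinearIsometryEquiv.norm_map _ _))
      (summable_norm_kernelPart X))
    (Summable.of_nonneg_of_le (fun _ => norm_nonneg _) (fun p => norm_opTensor_id_le _)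
      (summable_norm_kernelPart X))
  refine h3.congr_fun fun x => ?_
  rw [opTensorL_apply, opTensorL_apply, kernelPart_ampliation_kernelPart]
  simp only [star_kernelCoeff_mul]

theorem norm_berezinKernel_le (X : polyball n H) : ‖berezinKernel X‖ ≤ 1 := by
  have h1 := ContinuousLinearMap.norm_adjoint_comp_self (berezinKernel X)
  rw [adjoint_berezinKernel_comp] at h1
  have h2 : ‖ContinuousLinearMap.id ℂ H‖ ≤ 1 := ContinuousLinearMap.norm_id_le
  nlinarith [norm_nonneg (berezinKernel X)]

theorem norm_berezinExt_le (X : polyball n H)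
    (A : HTensor E (Fock.{u} n) →L[ℂ] HTensor E (Fock.{u} n)) : ‖berezinExt X A‖ ≤ ‖A‖ := by
  have h1 := (norm_opTensor_id_le (E := E) (berezinKernel X)).trans (norm_berezinKernel_le X)
  have h2 := norm_opTensor_id_le (E := E) (ContinuousLinearMap.adjoint (berezinKernel X))
  rw [LinearIsometryEquiv.norm_map] at h2
  have h3 := h2.trans (norm_berezinKernel_le X)
  rw [berezinExt_eq]
  calc _ ≤ _ * (_ * _) := (ContinuousLinearMap.opNorm_comp_le _ _).trans
            (mul_le_mul_of_nonneg_left (ContinuousLinearMap.opNorm_comp_le _ _) (norm_nonneg _))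
    _ ≤ 1 * (‖A‖ * 1) := by
      gcongr
      exact norm_ampliation_le A
    _ = ‖A‖ := by ring

end Expansion

/-! ### Multi-Toeplitz operators and their Fourier coefficients -/

section Toeplitz

variable {k : ℕ} {n : Fin k → ℕ}

/-- The tuple `α`, with the letter `s` put at the end of its `i`-th word. -/
abbrev wordSnoc (α : Word n) (i : Fin k) (s : Fin (n i)) : Word n :=
  Function.update α i (α i ++ [s])

/-- The product of `k`-tuples of words. -/
abbrev wordMul (α γ : Word n) : Word n := fun i => α i ++ γ i

/-- The Toeplitz relation for a matrix indexed by `k`-tuples of words. -/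
def IsToeplitzMatrix {R : Type*} [Zero R] (N : Word n → Word n → R) : Prop :=
  ∀ i s t α β, N (wordSnoc α i s) (wordSnoc β i t) = if s = t then N α β else 0

theorem IsToeplitzMatrix.update {R : Type*} [Zero R] {N : Word n → Word n → R}
    (hN : IsToeplitzMatrix N) (i : Fin k) (α β : Word n) (w w' : List (Fin (n i)))
    (h : w.length = w'.length) :
    N (Function.update α i (α i ++ w)) (Function.update β i (β i ++ w')) =
      if w = w' then N α β else 0 := by
  induction w using List.reverseRecOn generalizing w' with
  | nil =>
    obtain rfl : w' = [] := List.length_eq_zero_iff.1 h.symm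
    simp
  | append_singleton w s ih =>
    induction w' using List.reverseRecOn with
    | nil => simp at h
    | append_singleton w' t _ =>
      have h' : w.length = w'.length := by simpa using h
      have h1 := hN i s t (Function.update α i (α i ++ w)) (Function.update β i (β i ++ w'))
      simp only [wordSnoc, Function.update_self, Function.update_idem, List.append_assoc] at h1
      rw [h1, ih w' h']
      by_cases hst : s = t <;> by_cases hw : w = w' <;> simp [hst, hw]

/-- The entries of a Toeplitz matrix are unchanged when a common suffix is cancelled, and they
vanish when suffixes of the same length differ. -/
theorem IsToeplitzMatrix.wordMul {R : Type*} [Zero R] {N : Word n → Word n → R}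
    (hN : IsToeplitzMatrix N) (α β γ δ : Word n) (h : ∀ i, (γ i).length = (δ i).length) :
    N (wordMul α γ) (wordMul β δ) = if γ = δ then N α β else 0 := by
  -- The suffixes are cancelled in the coordinates of a finite set `S`, one coordinate at a time.
  suffices hs : ∀ S : Finset (Fin k),
      N (fun i => if i ∈ S then α i ++ γ i else α i) (fun i => if i ∈ S then β i ++ δ i else β i) =
        if ∀ i ∈ S, γ i = δ i then N α β else 0 by
    have := hs Finset.univ
    simpa [funext_iff, Polyball.wordMul] using this
  intro S
  induction S using Finset.induction_on with
  | empty => simp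
  | insert i S hi ih =>
    have e : ∀ a c : Word n, (fun l => if l ∈ insert i S then a l ++ c l else a l) =
        Function.update (fun l => if l ∈ S then a l ++ c l else a l) i
          ((fun l => if l ∈ S then a l ++ c l else a l) i ++ c i) := fun a c => by
      funext l
      by_cases hl : l = i
      · subst hl; simp [hi]
      · simp [hl]
    rw [e α γ, e β δ, hN.update i _ _ _ _ (h i), ih]
    by_cases h1 : γ i = δ i <;> by_cases h2 : ∀ l ∈ S, γ l = δ l <;> simp [h1, h2]

variable {E : Type v} [NormedAddCommGroup E] [InnerProductSpace ℂ E]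

theorem opTensor_rightCreation_tmul (i : Fin k) (s : Fin (n i)) (x : E) (α : Word n) :
    opTensor (ContinuousLinearMap.id ℂ E) (rightCreation.{u} n i s) (tmul x (fockBasis α)) =
      tmul x (fockBasis (wordSnoc α i s)) := by
  rw [opTensor_tmul, rightCreation, shift_basis]
  rfl

variable [CompleteSpace E]

theorem slice_opTensor_star_rightCreation (i : Fin k) (s : Fin (n i)) (α : Word n)
    (z : HTensor E (Fock.{u} n)) :
    slice α (opTensor (ContinuousLinearMap.id ℂ E) (star (rightCreation.{u} n i s)) z) =
      slice (wordSnoc α i s) z := by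
  have h : opTensor (ContinuousLinearMap.id ℂ E) (star (rightCreation.{u} n i s)) =
      ContinuousLinearMap.adjoint
        (opTensor (ContinuousLinearMap.id ℂ E) (rightCreation.{u} n i s)) := by
    rw [opTensor_adjoint, ContinuousLinearMap.adjoint_id, ContinuousLinearMap.star_eq_adjoint]
  refine ext_inner_left ℂ fun x => ?_
  rw [inner_slice, inner_slice, h, ContinuousLinearMap.adjoint_inner_right,
    opTensor_rightCreation_tmul]

/-- The multi-Toeplitz condition is a relation between matrix entries, since `R_{i,t}` puts the
letter `t` at the end of the `i`-th word. -/
theorem mem_multiToeplitz_iff {A : HTensor E (Fock.{u} n) →L[ℂ] HTensor E (Fock.{u} n)} :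
    A ∈ multiToeplitz n E ↔ IsToeplitzMatrix (entry A) := by
  have key : ∀ i s t α β, entry
      (opTensor (ContinuousLinearMap.id ℂ E) (star (rightCreation.{u} n i s)) ∘L A ∘L
        opTensor (ContinuousLinearMap.id ℂ E) (rightCreation.{u} n i t)) α β =
      entry A (wordSnoc α i s) (wordSnoc β i t) := fun i s t α β => by
    ext x
    rw [entry_apply, entry_apply, ContinuousLinearMap.comp_apply, ContinuousLinearMap.comp_apply,
      opTensor_rightCreation_tmul, slice_opTensor_star_rightCreation]
  have hite : ∀ i (s t : Fin (n i)) α β, entry (if s = t then A else 0) α β =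
      if s = t then entry A α β else 0 := fun i s t α β => by
    split_ifs
    · rfl
    · rw [← entryL_apply, map_zero]
  constructor
  · intro hA i s t α β
    rw [← key, hA i s t, hite]
  · intro hA i s t
    refine ext_entry fun α β => ?_
    rw [key, hA, hite]

variable {H : Type u} [NormedAddCommGroup H] [InnerProductSpace ℂ H] [CompleteSpace H]

theorem monomial_wordMul (X : polyball n H) (α γ : Word n) :
    monomial X.1 (wordMul α γ) = monomial X.1 α * monomial X.1 γ := by
  rw [monomial, monomial, monomial, ← ofFn_prod_mul]
  · simp [wordProd]
  · intro i j hij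
    refine Commute.list_prod_left _ _ fun x hx => Commute.list_prod_right _ _ fun y hy => ?_
    obtain ⟨p, -, rfl⟩ := List.mem_map.1 hx
    obtain ⟨q, -, rfl⟩ := List.mem_map.1 hy
    exact X.2.1 i j hij p q

/-- Concatenation of tuples of words of prescribed lengths. -/
def finWordAppend (q t : Fin k → ℕ) :
    FinWord n q × FinWord n t ≃ FinWord n fun i => q i + t i :=
  (Equiv.arrowProdEquivProdArrow _ _ _).symm.trans
    (Equiv.piCongrRight fun i => Fin.appendEquiv (q i) (t i))

theorem toWord_finWordAppend {q t : Fin k → ℕ} (a : FinWord n q) (c : FinWord n t) :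
    (finWordAppend q t (a, c)).toWord = wordMul a.toWord c.toWord :=
  funext fun _ => List.ofFn_fin_append _ _

/-- A pair of multi-lengths `(q, p)` is determined by the multidegree `m = p - q` and by
`t = min q p`. -/
def degreeEquiv (k : ℕ) : (Fin k → ℤ) × (Fin k → ℕ) ≃ (Fin k → ℕ) × (Fin k → ℕ) where
  toFun x := (fun i => (-x.1 i).toNat + x.2 i, fun i => (x.1 i).toNat + x.2 i)
  invFun x := (fun i => (x.2 i : ℤ) - x.1 i, fun i => min (x.1 i) (x.2 i))
  left_inv x := by
    ext i
    · simp only; omega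
    · simp only; omega
  right_inv x := by
    ext i
    · simp only; omega
    · simp only; omega

/-- In the expansion of the Berezin transform of a multi-Toeplitz operator, the common suffixes of
multi-length `t` contribute the factor `Φ_X^t(Δ_X(I))`. -/
theorem sum_opTensor_entry_toeplitz (X : polyball n H)
    {A : HTensor E (Fock.{u} n) →L[ℂ] HTensor E (Fock.{u} n)} (hA : A ∈ multiToeplitz n E)
    (q p t : Fin k → ℕ) :
    ∑ b : FinWord n fun i => q i + t i, ∑ a : FinWord n fun i => p i + t i,
        opTensor (entry A b.toWord a.toWord)
          (monomial X.1 b.toWord * defect X.1 * star (monomial X.1 a.toWord)) =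
      ∑ b : FinWord n q, ∑ a : FinWord n p, opTensor (entry A b.toWord a.toWord)
          (monomial X.1 b.toWord * cpPow X.1 t (defect X.1) * star (monomial X.1 a.toWord)) := by
  have hT := (mem_multiToeplitz_iff.1 hA).wordMul
  simp only [← (finWordAppend _ t).sum_comp, Fintype.sum_prod_type, toWord_finWordAppend]
  refine Finset.sum_congr rfl fun b _ => ?_
  rw [Finset.sum_comm]
  refine Finset.sum_congr rfl fun a _ => ?_
  rw [cpPow_apply, Finset.mul_sum, Finset.sum_mul, opTensor_sum_right]
  refine Finset.sum_congr rfl fun c _ => ?_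
  rw [Finset.sum_eq_single c]
  · rw [hT _ _ _ _ fun i => rfl, if_pos rfl, monomial_wordMul, monomial_wordMul, star_mul]
    simp only [mul_assoc]
  · intro d _ hd
    rw [hT _ _ _ _ fun i => (c.length_toWord i).trans (d.length_toWord i).symm, if_neg,
      opTensor_zero_left]
    exact fun h => hd (FinWord.toWord_injective h).symm
  · simp

/-- The Berezin transform of a multi-Toeplitz operator is the absolutely convergent free
pluriharmonic series with the Fourier coefficients of the operator. -/
theorem hasSum_multiPart (X : polyball n H)
    {A : HTensor E (Fock.{u} n) →L[ℂ] HTensor E (Fock.{u} n)} (hA : A ∈ multiToeplitz n E) :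
    HasSum (multiPart (entry A) X.1) (berezinExt X A) := by
  have h1 := (degreeEquiv k).hasSum_iff.2 (hasSum_berezinExt X A)
  have h2 : HasSum (fun x : (Fin k → ℤ) × (Fin k → ℕ) =>
      ∑ b : FinWord n fun i => (-x.1 i).toNat, ∑ a : FinWord n fun i => (x.1 i).toNat,
        opTensor (entry A b.toWord a.toWord) (monomial X.1 b.toWord *
          cpPow X.1 x.2 (defect X.1) * star (monomial X.1 a.toWord))) (berezinExt X A) := by
    refine h1.congr_fun fun x => ?_
    exact (sum_opTensor_entry_toeplitz X hA _ _ x.2).symm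
  have h3 : ∀ α β : Word n, HasSum (fun t => opTensor (entry A α β) (monomial X.1 α *
      cpPow X.1 t (defect X.1) * star (monomial X.1 β)))
      (opTensor (entry A α β) (monomial X.1 α * star (monomial X.1 β))) := fun α β => by
    have h4 := ((hasSum_cpPow_defect X).2.mul_left (monomial X.1 α)).mul_right
      (star (monomial X.1 β))
    rw [mul_one] at h4
    exact h4.mapL (opTensorL (entry A α β))
  have h5 : ∀ m : Fin k → ℤ, HasSum (fun t =>
      ∑ b : FinWord n fun i => (-m i).toNat, ∑ a : FinWord n fun i => (m i).toNat,
        opTensor (entry A b.toWord a.toWord) (monomial X.1 b.toWord *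
          cpPow X.1 t (defect X.1) * star (monomial X.1 a.toWord)))
      (multiPart (entry A) X.1 m) := fun m =>
    hasSum_sum fun b _ => hasSum_sum fun a _ => h3 _ _
  exact h2.prod_fiberwise h5

end Toeplitz

/-! ### Iterated series -/

section IteratedSum

variable {V W : Type*} [NormedAddCommGroup V] [NormedAddCommGroup W]

theorem HasIntSum.unique {f : ℤ → V} {s t : V} (hs : HasIntSum f s) (ht : HasIntSum f t) :
    s = t := by
  obtain ⟨s₁, s₂, h₁, h₂, rfl⟩ := hs
  obtain ⟨t₁, t₂, h₃, h₄, rfl⟩ := ht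
  rw [tendsto_nhds_unique h₁ h₃, tendsto_nhds_unique h₂ h₄]

theorem HasIterSum.unique : ∀ {k : ℕ} {f : (Fin k → ℤ) → V} {s t : V},
    HasIterSum k f s → HasIterSum k f t → s = t
  | 0, _, _, _, hs, ht => Eq.trans (Eq.symm hs) ht
  | _ + 1, _, _, _, ⟨a, ha, ha'⟩, ⟨b, hb, hb'⟩ => by
      obtain rfl : a = b := funext fun m => HasIterSum.unique (ha m) (hb m)
      exact ha'.unique hb'

theorem HasIterSum.mapL [NormedSpace ℂ V] [NormedSpace ℂ W] (L : V →L[ℂ] W) :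
    ∀ {k : ℕ} {f : (Fin k → ℤ) → V} {s : V},
    HasIterSum k f s → HasIterSum k (fun m => L (f m)) (L s)
  | 0, _, _, hs => congrArg L hs
  | _ + 1, _, _, ⟨a, ha, s₁, s₂, h₁, h₂, hs⟩ => by
      refine ⟨fun m => L (a m), fun m => HasIterSum.mapL L (ha m), L s₁, L s₂, ?_, ?_,
        by rw [hs, map_add]⟩
      · simpa only [map_sum, Function.comp_def] using (L.continuous.tendsto _).comp h₁
      · simpa only [map_sum, Function.comp_def] using (L.continuous.tendsto _).comp h₂

variable [CompleteSpace V]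

theorem hasIntSum_of_hasSum {f : ℤ → V} {s : V} (hs : HasSum f s) : HasIntSum f s := by
  have h1 : Summable fun m : ℕ => f (m : ℤ) := hs.summable.comp_injective Nat.cast_injective
  have h2 : Summable fun m : ℕ => f (-(m + 1 : ℤ)) :=
    hs.summable.comp_injective (i := fun m : ℕ => -(m + 1 : ℤ)) fun a b h => by
      simpa using h
  refine ⟨_, _, h2.hasSum.tendsto_sum_nat, h1.hasSum.tendsto_sum_nat, ?_⟩
  rw [add_comm]
  exact hs.unique (h1.hasSum.of_nat_of_neg_add_one h2.hasSum)

/-- Unconditional convergence over `ℤ^k` implies iterated convergence to the same sum. -/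
theorem hasIterSum_of_hasSum : ∀ {k : ℕ} {f : (Fin k → ℤ) → V} {s : V},
    HasSum f s → HasIterSum k f s
  | 0, f, s, hs => (hasSum_unique f).unique hs
  | k + 1, f, s, hs => by
      let e : ℤ × (Fin k → ℤ) ≃ (Fin (k + 1) → ℤ) := Fin.consEquiv fun _ => ℤ
      have h1 : HasSum (fun x => f (e x)) s := e.hasSum_iff.2 hs
      have h2 : ∀ m, HasSum (fun t => f (e (m, t))) (∑' t, f (e (m, t))) := fun m =>
        (h1.summable.prod_factor m).hasSum
      exact ⟨_, fun m => hasIterSum_of_hasSum (h2 m), hasIntSum_of_hasSum (h1.prod_fiberwise h2)⟩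

theorem hasIterSum_single {k : ℕ} {f : (Fin k → ℤ) → V} (m : Fin k → ℤ)
    (h : ∀ l, l ≠ m → f l = 0) : HasIterSum k f (f m) :=
  hasIterSum_of_hasSum (hasSum_single m h)

end IteratedSum

/-! ### Free pluriharmonic series at the scaled universal model -/

section Model

variable {k : ℕ} {n : Fin k → ℕ}

/-- The prefixes of length `p i` of the words of `α`. -/
def wordTake (p : Fin k → ℕ) (α : Word n) : Word n := fun i => (α i).take (p i)

/-- What remains of the words of `α` when their prefixes of length `p i` are removed. -/
def wordDrop (p : Fin k → ℕ) (α : Word n) : Word n := fun i => (α i).drop (p i)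

theorem wordMul_take_drop (p : Fin k → ℕ) (α : Word n) :
    wordMul (wordTake p α) (wordDrop p α) = α :=
  funext fun _ => List.take_append_drop _ _

theorem wordMul_eq_iff (a γ α : Word n) :
    wordMul a γ = α ↔ a = wordTake (fun i => (a i).length) α ∧
      γ = wordDrop (fun i => (a i).length) α := by
  constructor
  · rintro rfl
    exact ⟨funext fun i => by simp [wordTake], funext fun i => by simp [wordDrop]⟩
  · rintro ⟨h1, rfl⟩
    exact (congrArg (wordMul · _) h1).trans (wordMul_take_drop _ α)

theorem wordProd_scaledModel_basis (r : ℝ) (i : Fin k) (w : List (Fin (n i))) (α : Word n) :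
    wordProd (scaledModel.{u} n r i) w (fockBasis α) =
      ((r : ℂ) ^ w.length) • fockBasis (Function.update α i (w ++ α i)) := by
  induction w with
  | nil => simp [wordProd]
  | cons j w ih =>
    rw [wordProd, List.map_cons, List.prod_cons, mul_apply_eq_comp, ← wordProd, ih, map_smul,
      scaledModel, _root_.smul_apply, leftCreation_basis, smul_smul, List.length_cons, pow_succ,
      Function.update_self, Function.update_idem]
    rfl

theorem monomial_scaledModel_basis (r : ℝ) (a α : Word n) :
    monomial (scaledModel.{u} n r) a (fockBasis α) =
      ((r : ℂ) ^ ∑ i, (a i).length) • fockBasis (wordMul a α) := by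
  have key : ∀ l : List (Fin k), l.Nodup →
      ((l.map fun i => wordProd (scaledModel.{u} n r i) (a i)).prod) (fockBasis α) =
        ((r : ℂ) ^ (l.map fun i => (a i).length).sum) •
          fockBasis fun i => if i ∈ l then a i ++ α i else α i := by
    intro l hl
    induction l with
    | nil => simp
    | cons i l ih =>
      obtain ⟨hi, hl⟩ := List.nodup_cons.1 hl
      rw [List.map_cons, List.prod_cons, mul_apply_eq_comp, ih hl, map_smul,
        wordProd_scaledModel_basis, smul_smul, ← pow_add, List.map_cons, List.sum_cons, add_comm]
      congr 2
      funext l'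
      by_cases h : l' = i
      · subst h; simp [hi]
      · simp [h]
  have h := key (List.finRange k) (List.nodup_finRange k)
  rw [monomial, List.ofFn_eq_map, h, ← List.ofFn_eq_map, List.sum_ofFn]
  simp

/-- The adjoint of a monomial at `r S` removes a prefix, or gives `0` if the prefix is absent. -/
theorem star_monomial_scaledModel_basis (r : ℝ) (a α : Word n) :
    star (monomial (scaledModel.{u} n r) a) (fockBasis α) =
      if a = wordTake (fun i => (a i).length) α then
        ((r : ℂ) ^ ∑ i, (a i).length) • fockBasis (wordDrop (fun i => (a i).length) α) else 0 := by
  refine fock_ext fun γ => ?_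
  rw [ContinuousLinearMap.star_eq_adjoint, ContinuousLinearMap.adjoint_inner_right,
    monomial_scaledModel_basis, inner_smul_left, inner_fockBasis]
  simp only [wordMul_eq_iff]
  by_cases h : a = wordTake (fun i => (a i).length) α
  · rw [if_pos h, inner_smul_right, inner_fockBasis, map_pow, Complex.conj_ofReal]
    congr 1
    exact if_congr (and_iff_right h) rfl rfl
  · rw [if_neg h, if_neg fun h' => h h'.1, mul_zero, inner_zero_right]

theorem inner_monomial_scaledModel (r : ℝ) (a b α β : Word n) :
    inner ℂ (fockBasis α) ((monomial (scaledModel.{u} n r) a *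
      star (monomial (scaledModel.{u} n r) b)) (fockBasis β)) =
      if (a = wordTake (fun i => (a i).length) α ∧ b = wordTake (fun i => (b i).length) β) ∧
        wordDrop (fun i => (a i).length) α = wordDrop (fun i => (b i).length) β then
        (r : ℂ) ^ (∑ i, (a i).length + ∑ i, (b i).length) else 0 := by
  rw [mul_apply_eq_comp, ← ContinuousLinearMap.adjoint_inner_left,
    ← ContinuousLinearMap.star_eq_adjoint, star_monomial_scaledModel_basis,
    star_monomial_scaledModel_basis]
  by_cases ha : a = wordTake (fun i => (a i).length) α
  · by_cases hb : b = wordTake (fun i => (b i).length) β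
    · rw [if_pos ha, if_pos hb, inner_smul_left, inner_smul_right, inner_fockBasis, map_pow,
        Complex.conj_ofReal, ← mul_assoc, ← pow_add, mul_ite, mul_one, mul_zero]
      exact if_congr (and_iff_right ⟨ha, hb⟩).symm rfl rfl
    · rw [if_neg hb, inner_zero_right, if_neg fun h => hb h.1.2]
  · rw [if_neg ha, inner_zero_left, if_neg fun h => ha h.1.1]

/-- The multidegree `(|β_i| - |α_i|)_i` of a matrix position. -/
def wordDegree (α β : Word n) : Fin k → ℤ := fun i => ((β i).length : ℤ) - (α i).length

/-- The absolute multidegree `∑ i, |m_i|`. -/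
def absDegree (m : Fin k → ℤ) : ℕ := ∑ i, (m i).natAbs

open Classical in
/-- The Toeplitz matrix with the coefficients `C`: its entry at `(α;β)` is `C (α';β')` if
`α = α' γ` and `β = β' γ` where, for every `i`, one of `α'_i` and `β'_i` is empty; the entry is `0`
if there is no such decomposition. -/
noncomputable def toeplitzMatrix {R : Type*} [Zero R] (C : Word n → Word n → R)
    (α β : Word n) : R :=
  if wordDrop (fun i => (-wordDegree α β i).toNat) α =
    wordDrop (fun i => (wordDegree α β i).toNat) β
  then C (wordTake (fun i => (-wordDegree α β i).toNat) α)
    (wordTake (fun i => (wordDegree α β i).toNat) β) else 0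

theorem isToeplitzMatrix_toeplitzMatrix {R : Type*} [Zero R] (C : Word n → Word n → R) :
    IsToeplitzMatrix (toeplitzMatrix C) := by
  intro i s t α β
  have hdeg : wordDegree (wordSnoc α i s) (wordSnoc β i t) = wordDegree α β := by
    funext l
    by_cases hl : l = i
    · subst hl; simp [wordDegree]
    · simp [wordDegree, hl]
  have htake : ∀ (p : Fin k → ℕ) (a : Word n) (j : Fin (n i)), p i ≤ (a i).length →
      wordTake p (wordSnoc a i j) = wordTake p a := fun p a j h => by
    funext l
    by_cases hl : l = i
    · subst hl; simp [wordTake, List.take_append_of_le_length h]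
    · simp [wordTake, hl]
  have hdrop : ∀ (p : Fin k → ℕ) (a : Word n) (j : Fin (n i)), p i ≤ (a i).length →
      wordDrop p (wordSnoc a i j) = wordSnoc (wordDrop p a) i j := fun p a j h => by
    funext l
    by_cases hl : l = i
    · subst hl; simp [wordDrop, List.drop_append_of_le_length h]
    · simp [wordDrop, hl]
  have hsnoc : ∀ γ δ : Word n, wordSnoc γ i s = wordSnoc δ i t ↔ γ = δ ∧ s = t := by
    intro γ δ
    constructor
    · intro h
      have hi := congrFun h i
      simp only [wordSnoc, Function.update_self] at hi
      obtain ⟨h1, h2⟩ := List.append_inj' hi rfl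
      refine ⟨funext fun l => ?_, by simpa using h2⟩
      by_cases hl : l = i
      · subst hl; exact h1
      · simpa [hl] using congrFun h l
    · rintro ⟨rfl, rfl⟩; rfl
  have hq : (-wordDegree α β i).toNat ≤ (α i).length := by simp only [wordDegree]; omega
  have hp : (wordDegree α β i).toNat ≤ (β i).length := by simp only [wordDegree]; omega
  rw [toeplitzMatrix, toeplitzMatrix, hdeg, htake _ α s hq, htake _ β t hp, hdrop _ α s hq,
    hdrop _ β t hp]
  simp only [hsnoc]
  by_cases h1 : s = t <;> simp [h1]

theorem IsToeplitzMatrix.eq_toeplitzMatrix {R : Type*} [Zero R] {N : Word n → Word n → R}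
    (hN : IsToeplitzMatrix N) : N = toeplitzMatrix N := by
  funext α β
  have h := hN.wordMul (wordTake (fun i => (-wordDegree α β i).toNat) α)
    (wordTake (fun i => (wordDegree α β i).toNat) β)
    (wordDrop (fun i => (-wordDegree α β i).toNat) α)
    (wordDrop (fun i => (wordDegree α β i).toNat) β) fun i => by
      simp only [wordDrop, List.length_drop, wordDegree]
      omega
  rw [wordMul_take_drop, wordMul_take_drop] at h
  rw [h, toeplitzMatrix]

theorem toeplitzMatrix_toWord {R : Type*} [Zero R] (C : Word n → Word n → R) (m : Fin k → ℤ)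
    (a : FinWord n fun i => (-m i).toNat) (b : FinWord n fun i => (m i).toNat) :
    toeplitzMatrix C a.toWord b.toWord = C a.toWord b.toWord := by
  have hdeg : wordDegree a.toWord b.toWord = m := funext fun i => by
    simp only [wordDegree, List.length_ofFn]
    omega
  have ht : ∀ {p : Fin k → ℕ} (c : FinWord n p), wordTake p c.toWord = c.toWord := fun c =>
    funext fun i => List.take_of_length_le (c.length_toWord i).le
  have hd : ∀ {p : Fin k → ℕ} (c : FinWord n p), wordDrop p c.toWord = fun _ => [] := fun c =>
    funext fun i => List.drop_of_length_le (c.length_toWord i).le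
  rw [toeplitzMatrix, hdeg, ht, ht, hd, hd, if_pos rfl]

variable {E : Type v} [NormedAddCommGroup E] [InnerProductSpace ℂ E]

/-- A free pluriharmonic series involves only the coefficients which the Toeplitz matrix keeps. -/
theorem multiPart_toeplitzMatrix {H : Type u} [NormedAddCommGroup H] [InnerProductSpace ℂ H]
    [CompleteSpace H] (C : Word n → Word n → (E →L[ℂ] E)) (X : Tuple n H) :
    multiPart (toeplitzMatrix C) X = multiPart C X :=
  funext fun m => Finset.sum_congr rfl fun a _ => Finset.sum_congr rfl fun b _ => by
    rw [← toeplitzMatrix_toWord C m a b]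

variable [CompleteSpace E]

open Classical in
/-- The part of multidegree `m` of a free pluriharmonic series at `r S` has its entries only at the
positions of degree `m`. -/
theorem entry_multiPart_scaledModel (C : Word n → Word n → (E →L[ℂ] E)) (r : ℝ) (m : Fin k → ℤ)
    (α β : Word n) :
    entry (multiPart C (scaledModel.{u} n r) m) α β =
      if m = wordDegree α β then ((r : ℂ) ^ absDegree m) • toeplitzMatrix C α β else 0 := by
  have hent : ∀ (D : E →L[ℂ] E) (a : FinWord n fun i => (-m i).toNat)
      (b : FinWord n fun i => (m i).toNat), entry (opTensor D
      (monomial (scaledModel.{u} n r) a.toWord *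
        star (monomial (scaledModel.{u} n r) b.toWord))) α β =
      if (a.toWord = wordTake (fun i => (-m i).toNat) α ∧
        b.toWord = wordTake (fun i => (m i).toNat) β) ∧
        wordDrop (fun i => (-m i).toNat) α = wordDrop (fun i => (m i).toNat) β then
        ((r : ℂ) ^ absDegree m) • D else 0 := fun D a b => by
    have hw : ∑ i, (a.toWord i).length + ∑ i, (b.toWord i).length = absDegree m := by
      rw [← Finset.sum_add_distrib, absDegree]
      refine Finset.sum_congr rfl fun i _ => ?_
      rw [a.length_toWord, b.length_toWord]
      omega
    ext x
    rw [entry_apply, opTensor_tmul, slice_tmul, inner_monomial_scaledModel, hw]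
    simp only [FinWord.length_toWord]
    split_ifs
    · rfl
    · exact zero_smul _ _
  have hsum : entry (multiPart C (scaledModel.{u} n r) m) α β =
      ∑ a : FinWord n fun i => (-m i).toNat, ∑ b : FinWord n fun i => (m i).toNat,
        if (a.toWord = wordTake (fun i => (-m i).toNat) α ∧
        b.toWord = wordTake (fun i => (m i).toNat) β) ∧
        wordDrop (fun i => (-m i).toNat) α = wordDrop (fun i => (m i).toNat) β then
        ((r : ℂ) ^ absDegree m) • C a.toWord b.toWord else 0 := by
    simp only [← hent, ← entryL_apply, ← map_sum]
    rfl
  rw [hsum]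
  -- The words `a` and `b` of a non-vanishing term are prefixes of `α` and `β`, and removing them
  -- leaves words of the same lengths; so `m` is the degree of `(α;β)` and there is one such term.
  by_cases hm : m = wordDegree α β
  · obtain ⟨a, ha⟩ := FinWord.exists_toWord (α := wordTake (fun i => (-m i).toNat) α)
      (p := fun i => (-m i).toNat) fun i => by
        simp only [wordTake, List.length_take, hm, wordDegree]; omega
    obtain ⟨b, hb⟩ := FinWord.exists_toWord (α := wordTake (fun i => (m i).toNat) β)
      (p := fun i => (m i).toNat) fun i => by
        simp only [wordTake, List.length_take, hm, wordDegree]; omega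
    rw [Finset.sum_eq_single a, Finset.sum_eq_single b, if_pos hm, toeplitzMatrix, ← hm, ← ha, ← hb]
    · simp
    · intro b' _ hb'
      rw [if_neg fun h => hb' (FinWord.toWord_injective (h.1.2.trans hb.symm))]
    · simp
    · intro a' _ ha'
      refine Finset.sum_eq_zero fun b' _ => ?_
      rw [if_neg fun h => ha' (FinWord.toWord_injective (h.1.1.trans ha.symm))]
    · simp
  · rw [if_neg hm]
    refine Finset.sum_eq_zero fun a _ => Finset.sum_eq_zero fun b _ => if_neg ?_
    rintro ⟨⟨ha, hb⟩, hd⟩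
    refine hm (funext fun i => ?_)
    have h1 := congrArg List.length (congrFun ha i)
    have h2 := congrArg List.length (congrFun hb i)
    have h3 := congrArg List.length (congrFun hd i)
    rw [a.length_toWord] at h1
    rw [b.length_toWord] at h2
    simp only [wordTake, wordDrop, List.length_take, List.length_drop] at h1 h2 h3
    simp only [wordDegree]
    omega

theorem entry_of_hasIterSum (C : Word n → Word n → (E →L[ℂ] E)) (r : ℝ)
    {T : HTensor E (Fock.{u} n) →L[ℂ] HTensor E (Fock.{u} n)}
    (hT : HasIterSum k (multiPart C (scaledModel.{u} n r)) T) (α β : Word n) :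
    entry T α β = ((r : ℂ) ^ absDegree (wordDegree α β)) • toeplitzMatrix C α β := by
  have h1 := hT.mapL (entryL α β)
  have h2 := hasIterSum_single (f := fun m => entryL α β (multiPart C (scaledModel.{u} n r) m))
    (wordDegree α β) fun m hm => by
      rw [entryL_apply, entry_multiPart_scaledModel, if_neg hm]
  have h3 := h1.unique h2
  rwa [entryL_apply, entryL_apply, entry_multiPart_scaledModel, if_pos rfl] at h3

/-- The entries of the Berezin transform at `r S` of a multi-Toeplitz operator arise from those of
the operator by damping with the powers of `r`. -/
theorem entry_berezinExt_scaledModel (r : ℝ) (hr : r ∈ Set.Ico (0 : ℝ) 1)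
    {A : HTensor E (Fock.{u} n) →L[ℂ] HTensor E (Fock.{u} n)} (hA : A ∈ multiToeplitz n E)
    (α β : Word n) :
    entry (berezinExt ⟨scaledModel.{u} n r, scaledModel_mem_polyball n r hr⟩ A) α β =
      ((r : ℂ) ^ absDegree (wordDegree α β)) • entry A α β := by
  have h1 := hasIterSum_of_hasSum
    (hasSum_multiPart (⟨scaledModel.{u} n r, scaledModel_mem_polyball n r hr⟩ : polyball n _) hA)
  rw [entry_of_hasIterSum (entry A) r h1, ← (mem_multiToeplitz_iff.1 hA).eq_toeplitzMatrix]

end Model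

/-! ### Radial limits -/

section Limits

theorem isClosed_setOf_tendsto_of_norm_le {ι V W : Type*} [NormedAddCommGroup V] [NormedSpace ℂ V]
    [NormedAddCommGroup W] [NormedSpace ℂ W] {T : ι → V →L[ℂ] W} {C : ℝ} (hT : ∀ i, ‖T i‖ ≤ C)
    (l : Filter ι) (A : V →L[ℂ] W) : IsClosed {z | Tendsto (fun i => T i z) l (𝓝 (A z))} := by
  refine Equicontinuous.isClosed_setOfPred_tendsto (UniformEquicontinuous.equicontinuous ?_)
    A.continuous
  refine LipschitzWith.uniformEquicontinuous _ C.toNNReal fun i => ?_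
  exact (T i).lipschitz.weaken (by
    rw [← norm_toNNReal]
    exact Real.toNNReal_le_toNNReal (hT i))

/-- Bounded families of operators on a Hilbert space have weak limits along ultrafilters. -/
theorem exists_weak_limit {ι V : Type*} [NormedAddCommGroup V] [InnerProductSpace ℂ V]
    [CompleteSpace V] (U : Ultrafilter ι) {T : ι → V →L[ℂ] V} {C : ℝ} (hT : ∀ i, ‖T i‖ ≤ C) :
    ∃ A : V →L[ℂ] V, ∀ x y, Tendsto (fun i => inner ℂ (T i x) y) U (𝓝 (inner ℂ (A x) y)) := by
  have hb : ∀ i x y, ‖inner ℂ (T i x) y‖ ≤ C * ‖x‖ * ‖y‖ := fun i x y =>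
    (norm_inner_le_norm _ _).trans (mul_le_mul_of_nonneg_right
      ((T i).le_of_opNorm_le (hT i) x) (norm_nonneg _))
  have hlim : ∀ x y, ∃ c : ℂ, Tendsto (fun i => inner ℂ (T i x) y) U (𝓝 c) := fun x y => by
    obtain ⟨c, -, hc⟩ := (isCompact_closedBall (0 : ℂ) (C * ‖x‖ * ‖y‖)).ultrafilter_le_nhds'
      (U.map fun i => inner ℂ (T i x) y) (Ultrafilter.mem_map.2 (Filter.univ_mem' fun i => by
        simpa using hb i x y))
    exact ⟨c, hc⟩
  choose c hc using hlim
  let B : V →ₗ⋆[ℂ] V →ₗ[ℂ] ℂ := LinearMap.mk₂'ₛₗ (starRingEnd ℂ) (RingHom.id ℂ) c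
    (fun x x' y => tendsto_nhds_unique (hc _ _) (by
      simpa only [map_add, inner_add_left] using (hc x y).add (hc x' y)))
    (fun a x y => tendsto_nhds_unique (hc _ _) (by
      simpa only [map_smul, inner_smul_left, smul_eq_mul] using
        (hc x y).const_mul ((starRingEnd ℂ) a)))
    (fun x y y' => tendsto_nhds_unique (hc _ _) (by
      simpa only [inner_add_right] using (hc x y).add (hc x y')))
    (fun a x y => tendsto_nhds_unique (hc _ _) (by
      simpa only [inner_smul_right, smul_eq_mul, RingHom.id_apply] using (hc x y).const_mul a))
  refine ⟨InnerProductSpace.continuousLinearMapOfBilin (B.mkContinuous₂ C fun x y =>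
    le_of_tendsto (hc x y).norm (Filter.univ_mem' fun i => hb i x y)), fun x y => ?_⟩
  rw [InnerProductSpace.continuousLinearMapOfBilin_apply]
  exact hc x y

variable {k : ℕ} {n : Fin k → ℕ} {E : Type v} [NormedAddCommGroup E] [InnerProductSpace ℂ E]

/-- Induction on `E ⊗ F`, from the vectors `x ⊗ e_α`. -/
theorem htensor_fock_induction {p : HTensor E (Fock.{u} n) → Prop} (hc : IsClosed {z | p z})
    (h0 : p 0) (hadd : ∀ z w, p z → p w → p (z + w)) (ht : ∀ x α, p (tmul x (fockBasis α)))
    (z : HTensor E (Fock.{u} n)) : p z := by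
  refine htensor_induction hc h0 hadd (fun x y => ?_) z
  have hy := (fock_hasSum y).mapL (tensorLeft x)
  refine hc.mem_of_tendsto hy (Filter.univ_mem' fun s => ?_)
  change p _
  induction s using Finset.cons_induction with
  | empty => simpa using h0
  | cons α s hα ih =>
    rw [Finset.sum_cons]
    refine hadd _ _ ?_ ih
    rw [tensorLeft_apply, tmul_smul, ← smul_tmul]
    exact ht _ _

variable [CompleteSpace E]

/-- Parseval's identity: the space `E ⊗ F` is the Hilbert sum of its slices. -/
theorem hasSum_norm_slice (z : HTensor E (Fock.{u} n)) :
    HasSum (fun α : Word n => ‖slice α z‖ ^ 2) (‖z‖ ^ 2) := by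
  classical
  let V : ULift.{u} (Word n) → E →ₗᵢ[ℂ] HTensor E (Fock.{u} n) := fun α =>
    { toLinearMap := (tensorRight (fockBasis α.down) : E →L[ℂ] HTensor E (Fock.{u} n))
      norm_map' := fun x => by
        change ‖tmul x (fockBasis α.down)‖ = _
        rw [norm_tmul, orthonormal_fockBasis.1, mul_one] }
  have hV : OrthogonalFamily ℂ (fun _ : ULift.{u} (Word n) => E) V := fun α β hαβ x y => by
    change inner ℂ (tmul x _) (tmul y _) = 0
    rw [inner_tmul, orthonormal_fockBasis.2 fun h => hαβ (ULift.down_injective h), mul_zero]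
  have hS : IsHilbertSum ℂ (fun _ : ULift.{u} (Word n) => E) V := by
    refine IsHilbertSum.mk hV fun z _ => ?_
    refine htensor_fock_induction (p := fun z => z ∈ (⨆ α, LinearMap.range
      (V α).toLinearMap).topologicalClosure) (Submodule.isClosed_topologicalClosure _)
      (zero_mem _) (fun _ _ => add_mem) (fun x α => ?_) z
    refine Submodule.le_topologicalClosure _
      (Submodule.mem_iSup_of_mem (p := fun α => LinearMap.range (V α).toLinearMap)
        (ULift.up α) ⟨x, rfl⟩)
  have hcoord : ∀ α : ULift.{u} (Word n), hS.linearIsometryEquiv z α = slice α.down z := fun α => by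
    refine ext_inner_left ℂ fun x => ?_
    refine (lp.inner_single_left (𝕜 := ℂ) (G := fun _ : ULift.{u} (Word n) => E) α x
      (hS.linearIsometryEquiv z)).symm.trans ?_
    rw [inner_slice, ← LinearIsometryEquiv.inner_map_map hS.linearIsometryEquiv.symm,
      hS.linearIsometryEquiv_symm_apply_single, LinearIsometryEquiv.symm_apply_apply]
    rfl
  have h := lp.hasSum_norm (p := 2) (by norm_num) (hS.linearIsometryEquiv z)
  simp only [hcoord, LinearIsometryEquiv.norm_map, ENNReal.toReal_ofNat, Real.rpow_ofNat] at h
  exact Equiv.ulift.{u}.hasSum_iff.1 h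

theorem tendsto_pow_absDegree {l : Filter (Set.Ico (0 : ℝ) 1)}
    (hl : l ≤ comap Subtype.val (𝓝 (1 : ℝ))) (d : ℕ) :
    Tendsto (fun r : Set.Ico (0 : ℝ) 1 => ((r.1 : ℂ) ^ d)) l (𝓝 1) := by
  have h1 : Tendsto (fun r : Set.Ico (0 : ℝ) 1 => r.1) l (𝓝 (1 : ℝ)) :=
    tendsto_comap.mono_left hl
  have h2 := ((Complex.continuous_ofReal.tendsto _).comp h1).pow d
  simpa using h2

/-- A multi-Toeplitz operator is the strong radial limit of its Berezin transform. On the vector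
`x ⊗ e_β`, the slices of the Berezin transform at `r S` are those of `A (x ⊗ e_β)`, damped with
powers of `r`, so that dominated convergence applies. -/
theorem tendsto_berezinExt_scaledModel {A : HTensor E (Fock.{u} n) →L[ℂ] HTensor E (Fock.{u} n)}
    (hA : A ∈ multiToeplitz n E) (z : HTensor E (Fock.{u} n)) :
    Tendsto (fun r : Set.Ico (0 : ℝ) 1 =>
      berezinExt ⟨scaledModel.{u} n r.1, scaledModel_mem_polyball n r.1 r.2⟩ A z)
      (comap Subtype.val (𝓝 (1 : ℝ))) (𝓝 (A z)) := by
  set T : Set.Ico (0 : ℝ) 1 → HTensor E (Fock.{u} n) →L[ℂ] HTensor E (Fock.{u} n) := fun r =>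
    berezinExt ⟨scaledModel.{u} n r.1, scaledModel_mem_polyball n r.1 r.2⟩ A with hT
  refine htensor_fock_induction (p := fun z => Tendsto (fun r => T r z) _ (𝓝 (A z)))
    (isClosed_setOf_tendsto_of_norm_le (fun r => norm_berezinExt_le _ A) _ A) ?_ ?_ ?_ z
  · simpa using tendsto_const_nhds
  · intro z w hz hw
    simpa only [map_add] using hz.add hw
  · intro x β
    -- By Parseval's identity, the squared distance is a series dominated by that of `‖w‖ ^ 2`.
    rw [tendsto_iff_norm_sub_tendsto_zero]
    set w := A (tmul x (fockBasis β))
    have hslice : ∀ r α, slice α (T r (tmul x (fockBasis β)) - w) =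
        ((r.1 : ℂ) ^ absDegree (wordDegree α β) - 1) • slice α w := fun r α => by
      rw [map_sub, ← entry_apply, hT]
      dsimp only
      rw [entry_berezinExt_scaledModel r.1 r.2 hA, _root_.smul_apply, entry_apply, sub_smul,
        one_smul]
    have hnorm : ∀ r, ‖T r (tmul x (fockBasis β)) - w‖ ^ 2 =
        ∑' α, ‖((r.1 : ℂ) ^ absDegree (wordDegree α β) - 1) • slice α w‖ ^ 2 := fun r => by
      rw [← (hasSum_norm_slice _).tsum_eq]
      simp only [hslice]
    have hlim : Tendsto (fun r : Set.Ico (0 : ℝ) 1 => ∑' α,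
        ‖((r.1 : ℂ) ^ absDegree (wordDegree α β) - 1) • slice α w‖ ^ 2)
        (comap Subtype.val (𝓝 (1 : ℝ))) (𝓝 (∑' α : Word n, (0 : ℝ))) := by
      refine tendsto_tsum_of_dominated_convergence (hasSum_norm_slice w).summable (fun α => ?_)
        (Filter.univ_mem' fun r α => ?_)
      · have h := (((tendsto_pow_absDegree le_rfl (absDegree (wordDegree α β))).sub_const
          1).smul_const (slice α w)).norm.pow 2
        simpa using h
      · rw [Real.norm_of_nonneg (by positivity), norm_smul]
        refine pow_le_pow_left₀ (by positivity) (mul_le_of_le_one_left (norm_nonneg _) ?_) 2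
        have h0 := pow_nonneg r.2.1 (absDegree (wordDegree α β))
        have h1 := pow_le_one₀ (n := absDegree (wordDegree α β)) r.2.1 r.2.2.le
        rw [← Complex.ofReal_pow, ← Complex.ofReal_one, ← Complex.ofReal_sub, Complex.norm_real,
          Real.norm_eq_abs, abs_le]
        constructor <;> linarith
    have h2 : Tendsto (fun r => Real.sqrt (‖T r (tmul x (fockBasis β)) - w‖ ^ 2))
        (comap Subtype.val (𝓝 (1 : ℝ))) (𝓝 (Real.sqrt 0)) := by
      simp only [hnorm]
      simpa using hlim.sqrt
    simpa only [Real.sqrt_sq (norm_nonneg _), Real.sqrt_zero] using h2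

instance neBot_comap_one :
    (comap (Subtype.val : Set.Ico (0 : ℝ) 1 → ℝ) (𝓝 (1 : ℝ))).NeBot := by
  rw [comap_neBot_iff]
  intro t ht
  obtain ⟨ε, hε, hball⟩ := Metric.mem_nhds_iff.1 ht
  have h1 : max 0 (1 - ε / 2) < 1 := max_lt one_pos (by linarith)
  refine ⟨⟨max 0 (1 - ε / 2), le_max_left _ _, h1⟩, hball ?_⟩
  rw [Metric.mem_ball, Real.dist_eq, abs_lt]
  have h2 : 1 - ε / 2 ≤ max 0 (1 - ε / 2) := le_max_right _ _
  constructor <;> dsimp only <;> linarith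

/-- Every bounded free pluriharmonic function is the Berezin transform of a multi-Toeplitz
operator, namely of a weak limit of the operators `F(rS)`, which has the coefficients of `F` as its
Fourier coefficients. -/
theorem exists_multiToeplitz {F : PolyballFunction.{u} n E} (hF : IsFreePluriharmonic F)
    (hb : IsBoundedFunction F) : ∃ A ∈ multiToeplitz.{u} n E,
      ∀ (H : HilbSpace.{u}) (X : polyball n H), (F H X).1 = berezinExt X A := by
  obtain ⟨C, hC⟩ := hF
  obtain ⟨M, hM⟩ := hb ⟨Fock.{u} n⟩
  let T : Set.Ico (0 : ℝ) 1 → HTensor E (Fock.{u} n) →L[ℂ] HTensor E (Fock.{u} n) := fun r =>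
    (F ⟨Fock.{u} n⟩ ⟨scaledModel n r.1, scaledModel_mem_polyball n r.1 r.2⟩).1
  let U := Ultrafilter.of (comap (Subtype.val : Set.Ico (0 : ℝ) 1 → ℝ) (𝓝 (1 : ℝ)))
  obtain ⟨A, hA⟩ := exists_weak_limit U (T := T) (fun r => hM _)
  have hentry : entry A = toeplitzMatrix C := by
    funext α β
    ext x
    refine ext_inner_right ℂ fun y => ?_
    have hin : ∀ B : HTensor E (Fock.{u} n) →L[ℂ] HTensor E (Fock.{u} n),
        inner ℂ (entry B α β x) y = inner ℂ (B (tmul x (fockBasis β))) (tmul y (fockBasis α)) :=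
      fun B => by rw [entry_apply, ← inner_conj_symm, inner_slice, inner_conj_symm]
    have h1 := hA (tmul x (fockBasis β)) (tmul y (fockBasis α))
    simp only [← hin] at h1
    refine tendsto_nhds_unique h1 ?_
    have h2 : ∀ r, entry (T r) α β =
        ((r.1 : ℂ) ^ absDegree (wordDegree α β)) • toeplitzMatrix C α β := fun r =>
      entry_of_hasIterSum C r.1 (hC ⟨Fock.{u} n⟩ ⟨_, scaledModel_mem_polyball n r.1 r.2⟩) α β
    simp only [h2, _root_.smul_apply]
    have h3 := (tendsto_pow_absDegree (Ultrafilter.of_le _)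
      (absDegree (wordDegree α β))).smul_const (toeplitzMatrix C α β x)
    rw [one_smul] at h3
    exact h3.inner tendsto_const_nhds
  have hAT : A ∈ multiToeplitz.{u} n E := by
    rw [mem_multiToeplitz_iff, hentry]
    exact isToeplitzMatrix_toeplitzMatrix C
  refine ⟨A, hAT, fun H X => (hC H X).unique ?_⟩
  have h := hasIterSum_of_hasSum (hasSum_multiPart X hAT)
  rwa [hentry, multiPart_toeplitzMatrix] at h

end Limits

/-! ### Transport along an isometry -/

section Transport

variable {k : ℕ} {n : Fin k → ℕ} {G H : Type u} [NormedAddCommGroup G] [InnerProductSpace ℂ G]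
  [CompleteSpace G] [NormedAddCommGroup H] [InnerProductSpace ℂ H] [CompleteSpace H]

theorem adjoint_linearIsometry_apply (V : G →ₗᵢ[ℂ] H) (x : G) :
    ContinuousLinearMap.adjoint V.toContinuousLinearMap (V x) = x := by
  refine ext_inner_left ℂ fun y => ?_
  rw [ContinuousLinearMap.adjoint_inner_right]
  exact V.inner_map_map y x

/-- The operator `V Y V^*` on `H`, where `V : G → H` is an isometry. -/
noncomputable def transport (V : G →ₗᵢ[ℂ] H) (Y : G →L[ℂ] G) : H →L[ℂ] H :=
  V.toContinuousLinearMap ∘L Y ∘L ContinuousLinearMap.adjoint V.toContinuousLinearMap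

theorem transport_apply (V : G →ₗᵢ[ℂ] H) (Y : G →L[ℂ] G) (x : H) :
    transport V Y x = V (Y (ContinuousLinearMap.adjoint V.toContinuousLinearMap x)) := rfl

theorem transport_mul (V : G →ₗᵢ[ℂ] H) (Y Z : G →L[ℂ] G) :
    transport V (Y * Z) = transport V Y * transport V Z := by
  ext x
  simp only [mul_apply_eq_comp, transport_apply, adjoint_linearIsometry_apply]

theorem transport_star (V : G →ₗᵢ[ℂ] H) (Y : G →L[ℂ] G) :
    transport V (star Y) = star (transport V Y) := by
  simp only [transport, ContinuousLinearMap.star_eq_adjoint, ContinuousLinearMap.adjoint_comp,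
    ContinuousLinearMap.adjoint_adjoint]
  rfl

theorem transport_sum {ι : Type*} (V : G →ₗᵢ[ℂ] H) (s : Finset ι) (f : ι → G →L[ℂ] G) :
    transport V (∑ i ∈ s, f i) = ∑ i ∈ s, transport V (f i) := by
  ext x
  simp [transport_apply, _root_.sum_apply]

theorem transport_sub (V : G →ₗᵢ[ℂ] H) (Y Z : G →L[ℂ] G) :
    transport V (Y - Z) = transport V Y - transport V Z := by
  ext x
  simp [transport_apply]

theorem norm_transport_le (V : G →ₗᵢ[ℂ] H) (Y : G →L[ℂ] G) : ‖transport V Y‖ ≤ ‖Y‖ := by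
  refine ContinuousLinearMap.opNorm_le_bound _ (norm_nonneg _) fun x => ?_
  rw [transport_apply, LinearIsometry.norm_map]
  refine (Y.le_opNorm _).trans (mul_le_mul_of_nonneg_left ?_ (norm_nonneg _))
  refine ((ContinuousLinearMap.adjoint V.toContinuousLinearMap).le_opNorm x).trans
    (mul_le_of_le_one_left (norm_nonneg _) ?_)
  rw [LinearIsometryEquiv.norm_map]
  exact V.norm_toContinuousLinearMap_le

/-- The operator which is unitarily equivalent to `Y` on the range of `V` and the identity on its
orthogonal complement. -/
noncomputable def transportOne (V : G →ₗᵢ[ℂ] H) (Y : G →L[ℂ] G) : H →L[ℂ] H :=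
  1 - transport V 1 + transport V Y

theorem transportOne_mul (V : G →ₗᵢ[ℂ] H) (Y Z : G →L[ℂ] G) :
    transportOne V (Y * Z) = transportOne V Y * transportOne V Z := by
  simp only [transportOne, mul_add, add_mul, mul_sub, sub_mul, one_mul, mul_one, ← transport_mul]
  abel

theorem transportOne_one (V : G →ₗᵢ[ℂ] H) : transportOne V 1 = 1 := by
  rw [transportOne, sub_add_cancel]

theorem isStrictlyPositive_transportOne (V : G →ₗᵢ[ℂ] H) {Y : G →L[ℂ] G}
    (hY : IsStrictlyPositive Y) : IsStrictlyPositive (transportOne V Y) := by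
  refine ⟨add_nonneg ?_ ?_, ?_⟩
  · have hP : IsStarProjection (transport V 1) :=
      ⟨by rw [IsIdempotentElem, ← transport_mul, mul_one], by
        rw [IsSelfAdjoint, ← transport_star, star_one]⟩
    exact hP.one_sub.nonneg
  · rw [ContinuousLinearMap.nonneg_iff_isPositive]
    exact ((ContinuousLinearMap.nonneg_iff_isPositive Y).1 hY.nonneg).conj_adjoint
      V.toContinuousLinearMap
  · obtain ⟨Z, hZ⟩ := hY.isUnit
    refine ⟨⟨transportOne V Y, transportOne V ↑Z⁻¹, ?_, ?_⟩, rfl⟩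
    · rw [← transportOne_mul, ← hZ, Units.mul_inv, transportOne_one]
    · rw [← transportOne_mul, ← hZ, Units.inv_mul, transportOne_one]

/-- The part of `transportOne V Y` on the orthogonal complement of the range of `V` is annihilated
by the transported tuple. -/
theorem cpMap_transport {m : ℕ} (V : G →ₗᵢ[ℂ] H) (T : Fin m → (G →L[ℂ] G)) (Y : G →L[ℂ] G) :
    cpMap (fun j => transport V (T j)) (transportOne V Y) = transport V (cpMap T Y) := by
  rw [cpMap_apply, cpMap_apply, transport_sum]
  refine Finset.sum_congr rfl fun j _ => ?_
  rw [← transport_star]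
  simp only [transportOne, mul_add, add_mul, mul_sub, sub_mul, mul_one, ← transport_mul]
  abel

/-- Transport along an isometry preserves the polyball. -/
theorem transport_mem_polyball (V : G →ₗᵢ[ℂ] H) (X : polyball n G) :
    (fun i j => transport V (X.1 i j)) ∈ polyball n H := by
  refine ⟨fun s t hst p q => ?_, fun i => ?_, ?_⟩
  · rw [← transport_mul, ← transport_mul, X.2.1 s t hst p q]
  · simp only [← transport_star, ← transport_mul, ← transport_sum]
    exact (norm_transport_le V _).trans_lt (X.2.2.1 i)
  · suffices h : defect (fun i j => transport V (X.1 i j)) = transportOne V (defect X.1) by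
      rw [h]
      exact isStrictlyPositive_transportOne V X.2.2.2
    rw [defect, defect, List.ofFn_eq_map, List.ofFn_eq_map]
    induction List.finRange k with
    | nil => exact (transportOne_one V).symm
    | cons i l ih =>
      rw [List.map_cons, List.prod_cons, List.map_cons, List.prod_cons, Module.End.mul_apply, ih,
        Module.End.mul_apply, LinearMap.sub_apply, LinearMap.sub_apply, Module.End.one_apply,
        Module.End.one_apply, cpMap_transport, transportOne, transportOne, transport_sub]
      abel

/-- The range of `V` is coinvariant under the monomials of the transported tuple. -/
theorem adjoint_monomial_transport (V : G →ₗᵢ[ℂ] H) (X : Tuple n G) (α : Word n) :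
    ContinuousLinearMap.adjoint V.toContinuousLinearMap ∘L
      monomial (fun i j => transport V (X i j)) α =
    monomial X α ∘L ContinuousLinearMap.adjoint V.toContinuousLinearMap := by
  have hword : ∀ i (w : List (Fin (n i))) (x : H),
      ContinuousLinearMap.adjoint V.toContinuousLinearMap
        (wordProd (fun j => transport V (X i j)) w x) =
      wordProd (X i) w (ContinuousLinearMap.adjoint V.toContinuousLinearMap x) := by
    intro i w x
    induction w with
    | nil => rfl
    | cons j w ih =>
      simp only [wordProd, List.map_cons, List.prod_cons, mul_apply_eq_comp] at ih ⊢
      rw [transport_apply, adjoint_linearIsometry_apply, ih]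
  ext x
  rw [monomial, monomial, List.ofFn_eq_map, List.ofFn_eq_map, ContinuousLinearMap.comp_apply,
    ContinuousLinearMap.comp_apply]
  induction List.finRange k with
  | nil => rfl
  | cons i l ih =>
    rw [List.map_cons, List.prod_cons, List.map_cons, List.prod_cons, mul_apply_eq_comp,
      mul_apply_eq_comp, hword, ih]

variable {E : Type v} [NormedAddCommGroup E] [InnerProductSpace ℂ E]

theorem multiPart_transport (V : G →ₗᵢ[ℂ] H) (X : Tuple n G)
    (C : Word n → Word n → (E →L[ℂ] E)) (m : Fin k → ℤ) :
    opTensor (ContinuousLinearMap.id ℂ E)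
        (ContinuousLinearMap.adjoint V.toContinuousLinearMap) ∘L
      multiPart C (fun i j => transport V (X i j)) m ∘L
      opTensor (ContinuousLinearMap.id ℂ E) V.toContinuousLinearMap = multiPart C X m := by
  have hterm : ∀ α β : Word n, ContinuousLinearMap.adjoint V.toContinuousLinearMap ∘L
      (monomial (fun i j => transport V (X i j)) α *
        star (monomial (fun i j => transport V (X i j)) β)) ∘L V.toContinuousLinearMap =
      monomial X α * star (monomial X β) := fun α β => by
    have h1 := congrArg ContinuousLinearMap.adjoint (adjoint_monomial_transport V X β)
    rw [ContinuousLinearMap.adjoint_comp, ContinuousLinearMap.adjoint_comp,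
      ContinuousLinearMap.adjoint_adjoint] at h1
    ext x
    have h2 := congrArg (fun T => T x) h1
    have h3 := fun y => congrArg (fun T => T y) (adjoint_monomial_transport V X α)
    simp only [ContinuousLinearMap.comp_apply] at h2 h3
    rw [ContinuousLinearMap.comp_apply, ContinuousLinearMap.comp_apply, mul_apply_eq_comp, h3,
      ContinuousLinearMap.star_eq_adjoint, h2, LinearIsometry.coe_toContinuousLinearMap,
      adjoint_linearIsometry_apply]
    rfl
  simp only [multiPart, ContinuousLinearMap.comp_finsetSum, ContinuousLinearMap.finsetSum_comp]
  refine Finset.sum_congr rfl fun a _ => Finset.sum_congr rfl fun b _ => ?_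
  rw [opTensor_comp, opTensor_comp, ContinuousLinearMap.comp_id, ContinuousLinearMap.id_comp, hterm]

variable [CompleteSpace E]

/-- The Berezin transform at a transported tuple compresses to the one at the original tuple. -/
theorem berezinExt_transport (V : G →ₗᵢ[ℂ] H) (X : polyball n G)
    {A : HTensor E (Fock.{u} n) →L[ℂ] HTensor E (Fock.{u} n)} (hA : A ∈ multiToeplitz n E) :
    opTensor (ContinuousLinearMap.id ℂ E)
        (ContinuousLinearMap.adjoint V.toContinuousLinearMap) ∘L
      berezinExt ⟨_, transport_mem_polyball V X⟩ A ∘L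
      opTensor (ContinuousLinearMap.id ℂ E) V.toContinuousLinearMap = berezinExt X A := by
  have h1 := hasSum_multiPart
    (⟨fun i j => transport V (X.1 i j), transport_mem_polyball V X⟩ : polyball n H) hA
  have h2 := h1.mapL (ContinuousLinearMap.compL ℂ (HTensor E G) (HTensor E H) (HTensor E G)
      (opTensor (ContinuousLinearMap.id ℂ E)
        (ContinuousLinearMap.adjoint V.toContinuousLinearMap)) ∘L
    (ContinuousLinearMap.compL ℂ (HTensor E G) (HTensor E H) (HTensor E H)).flip
      (opTensor (ContinuousLinearMap.id ℂ E) V.toContinuousLinearMap))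
  refine HasSum.unique h2 ((hasSum_multiPart X hA).congr_fun fun m => ?_)
  exact multiPart_transport V X.1 (entry A) m

/-- The Fock space has a countable orthonormal basis, so it embeds into every infinite dimensional
Hilbert space. -/
theorem exists_isometry_fock (hH : ¬ FiniteDimensional ℂ H) : Nonempty (Fock.{u} n →ₗᵢ[ℂ] H) := by
  obtain ⟨w, b, -⟩ := exists_hilbertBasis ℂ H
  have hw : Infinite w := by
    by_contra hfin
    rw [not_infinite_iff_finite] at hfin
    have := Fintype.ofFinite w
    exact hH b.toOrthonormalBasis.toBasis.finiteDimensional_of_finite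
  obtain ⟨f, hf⟩ := Countable.exists_injective_nat (ULift.{u} (Word n))
  exact ⟨(b.orthonormal.comp (fun α => Infinite.natEmbedding w (f α))
    ((Infinite.natEmbedding w).injective.comp hf)).orthogonalFamily.linearIsometry⟩

end Transport

/-! ### Linearity and injectivity of the Berezin transform -/

section Linear

variable {k : ℕ} {n : Fin k → ℕ} {E : Type v} [NormedAddCommGroup E] [InnerProductSpace ℂ E]
  [CompleteSpace E] {H : Type u} [NormedAddCommGroup H] [InnerProductSpace ℂ H] [CompleteSpace H]

theorem berezinExt_add (X : polyball n H)
    (A B : HTensor E (Fock.{u} n) →L[ℂ] HTensor E (Fock.{u} n)) :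
    berezinExt X (A + B) = berezinExt X A + berezinExt X B := by
  rw [berezinExt, opTensor_add_left, ContinuousLinearMap.add_comp, ContinuousLinearMap.comp_add,
    ContinuousLinearMap.comp_add]
  rfl

theorem berezinExt_smul (X : polyball n H) (c : ℂ)
    (A : HTensor E (Fock.{u} n) →L[ℂ] HTensor E (Fock.{u} n)) :
    berezinExt X (c • A) = c • berezinExt X A := by
  rw [berezinExt, opTensor_smul_left, ContinuousLinearMap.smul_comp, ContinuousLinearMap.comp_smul,
    ContinuousLinearMap.comp_smul]
  rfl

/-- A multi-Toeplitz operator is determined by its Berezin transform on the polyball of any one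
infinite dimensional Hilbert space. -/
theorem eq_of_berezinExt_eq (hH : ¬ FiniteDimensional ℂ H)
    {A B : HTensor E (Fock.{u} n) →L[ℂ] HTensor E (Fock.{u} n)} (hA : A ∈ multiToeplitz n E)
    (hB : B ∈ multiToeplitz n E) (h : ∀ X : polyball n H, berezinExt X A = berezinExt X B) :
    A = B := by
  obtain ⟨V⟩ := exists_isometry_fock (n := n) hH
  ext z
  refine tendsto_nhds_unique (tendsto_berezinExt_scaledModel hA z) ?_
  refine (tendsto_berezinExt_scaledModel hB z).congr fun r => ?_
  rw [← berezinExt_transport V _ hA, ← berezinExt_transport V _ hB, h]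

end Linear

/-! ### Operator matrices -/

section MatrixOp

variable {K : Type*} [NormedAddCommGroup K] [InnerProductSpace ℂ K] {m : ℕ}

theorem matrixOp_apply (M : Matrix (Fin m) (Fin m) (K →L[ℂ] K)) (x : PiLp 2 fun _ : Fin m => K)
    (i : Fin m) : matrixOp M x i = ∑ j, M i j (x j) := by
  simp [matrixOp, _root_.sum_apply]

/-- The embedding of the `j`-th summand into the `m`-fold Hilbert direct sum of `K`. -/
noncomputable def sumEmb (K : Type*) [NormedAddCommGroup K] [InnerProductSpace ℂ K] (j : Fin m) :
    K →L[ℂ] PiLp 2 fun _ : Fin m => K :=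
  ((PiLp.continuousLinearEquiv 2 ℂ fun _ : Fin m => K).symm : _ →L[ℂ] _) ∘L
    ContinuousLinearMap.single ℂ (fun _ : Fin m => K) j

theorem sumEmb_apply (i j : Fin m) (x : K) : sumEmb K j x i = if i = j then x else 0 := by
  by_cases h : i = j
  · subst h; simp [sumEmb]
  · simp [sumEmb, h]

theorem proj_comp_sumEmb (i j : Fin m) :
    PiLp.proj 2 (fun _ : Fin m => K) i ∘L sumEmb K j =
      if i = j then ContinuousLinearMap.id ℂ K else 0 := by
  ext x
  rw [ContinuousLinearMap.comp_apply]
  change sumEmb K j x i = _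
  rw [sumEmb_apply]
  split_ifs <;> rfl

theorem proj_comp_matrixOp_comp_sumEmb (M : Matrix (Fin m) (Fin m) (K →L[ℂ] K)) (i j : Fin m) :
    PiLp.proj 2 (fun _ : Fin m => K) i ∘L matrixOp M ∘L sumEmb K j = M i j := by
  ext x
  change matrixOp M (sumEmb K j x) i = _
  rw [matrixOp_apply, Finset.sum_eq_single j]
  · rw [sumEmb_apply, if_pos rfl]
  · intro l _ hl
    rw [sumEmb_apply, if_neg hl, map_zero]
  · simp

theorem sum_sumEmb_comp_proj :
    ∑ j, sumEmb K j ∘L PiLp.proj 2 (fun _ : Fin m => K) j = ContinuousLinearMap.id ℂ _ := by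
  ext x i
  simp [_root_.sum_apply, sumEmb_apply]

theorem adjoint_sumEmb [CompleteSpace K] (j : Fin m) :
    ContinuousLinearMap.adjoint (sumEmb K j) = PiLp.proj 2 (fun _ : Fin m => K) j := by
  refine (ContinuousLinearMap.eq_adjoint_iff _ _).2 (fun x y => ?_) |>.symm
  rw [PiLp.inner_apply, Finset.sum_eq_single j]
  · rw [sumEmb_apply, if_pos rfl]
    rfl
  · intro l _ hl
    rw [sumEmb_apply, if_neg hl, inner_zero_right]
  · simp

theorem tendsto_matrixOp {ι : Type*} {l : Filter ι} {M : ι → Matrix (Fin m) (Fin m) (K →L[ℂ] K)}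
    {N : Matrix (Fin m) (Fin m) (K →L[ℂ] K)}
    (h : ∀ i j x, Tendsto (fun r => M r i j x) l (𝓝 (N i j x))) (x : PiLp 2 fun _ : Fin m => K) :
    Tendsto (fun r => matrixOp (M r) x) l (𝓝 (matrixOp N x)) := by
  have h1 : Tendsto (fun r => fun i => matrixOp (M r) x i) l (𝓝 fun i => matrixOp N x i) := by
    refine tendsto_pi_nhds.2 fun i => ?_
    simp only [matrixOp_apply]
    exact tendsto_finsetSum _ fun j _ => h i j _
  exact ((PiLp.continuous_toLp 2 fun _ : Fin m => K).tendsto _).comp h1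

variable [CompleteSpace K] {H : Type*} [NormedAddCommGroup H] [InnerProductSpace ℂ H]
  [CompleteSpace H]

/-- The ampliation `M ⊗ I_H` of an operator matrix has at most the norm of the matrix: the
`m`-fold direct sum of `K ⊗ H` is identified with `K^m ⊗ H`. -/
theorem norm_matrixOp_opTensor_le (M : Matrix (Fin m) (Fin m) (K →L[ℂ] K)) :
    ‖matrixOp (Matrix.of fun i j => opTensor (M i j) (ContinuousLinearMap.id ℂ H))‖ ≤
      ‖matrixOp M‖ := by
  -- The coordinate projections and embeddings of `K^m`, tensored with the identity of `H`, satisfy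
  -- the relations which exhibit `K^m ⊗ H` as the `m`-fold Hilbert direct sum of `K ⊗ H`.
  set I := ContinuousLinearMap.id ℂ H
  let π : Fin m → HTensor (PiLp 2 fun _ : Fin m => K) H →L[ℂ] HTensor K H := fun i =>
    opTensor (PiLp.proj 2 (fun _ : Fin m => K) i) I
  let ι : Fin m → HTensor K H →L[ℂ] HTensor (PiLp 2 fun _ : Fin m => K) H := fun j =>
    opTensor (sumEmb K j) I
  have hadj : ∀ j, ContinuousLinearMap.adjoint (ι j) = π j := fun j => by
    simp only [ι, π, I, opTensor_adjoint, adjoint_sumEmb, ContinuousLinearMap.adjoint_id]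
  have hπι : ∀ i j, π i ∘L ι j = if i = j then ContinuousLinearMap.id ℂ _ else 0 := fun i j => by
    simp only [ι, π, I, opTensor_comp, proj_comp_sumEmb]
    split_ifs
    · exact opTensor_id
    · exact opTensor_zero_left _
  have hsum : ∑ j, ι j ∘L π j = ContinuousLinearMap.id ℂ _ := by
    simp only [ι, π, I, opTensor_comp, ContinuousLinearMap.id_comp]
    rw [← opTensor_id, ← sum_sumEmb_comp_proj, opTensor_sum_left]
  have hM : ∀ i j, π i ∘L opTensor (matrixOp M) I ∘L ι j = opTensor (M i j) I := fun i j => by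
    simp only [ι, π, I, opTensor_comp, ContinuousLinearMap.id_comp,
      proj_comp_matrixOp_comp_sumEmb]
  have hnorm : ∀ z, ∑ i, ‖π i z‖ ^ 2 = ‖z‖ ^ 2 := fun z => by
    have h1 := congrArg (fun T => RCLike.re (inner ℂ (T z) z)) hsum
    have h2 : ∀ i, inner ℂ (ι i (π i z)) z = inner ℂ (π i z) (π i z) := fun i => by
      rw [← hadj, ContinuousLinearMap.adjoint_inner_right]
    simp only [_root_.sum_apply, sum_inner, map_sum, ContinuousLinearMap.comp_apply,
      ContinuousLinearMap.coe_id', id_eq, h2, inner_self_eq_norm_sq] at h1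
    exact h1
  refine ContinuousLinearMap.opNorm_le_bound _ (norm_nonneg _) fun y => ?_
  set z := ∑ j, ι j (y j) with hz
  have hπz : ∀ i, π i z = y i := fun i => by
    rw [hz, map_sum, Finset.sum_eq_single i]
    · rw [← ContinuousLinearMap.comp_apply, hπι, if_pos rfl]
      rfl
    · intro j _ hj
      rw [← ContinuousLinearMap.comp_apply, hπι, if_neg hj.symm]
      rfl
    · simp
  have hyz : ‖y‖ = ‖z‖ := by
    rw [← sq_eq_sq₀ (norm_nonneg _) (norm_nonneg _), ← hnorm, PiLp.norm_sq_eq_of_L2]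
    simp only [hπz]
  have hMy : ‖matrixOp (Matrix.of fun i j => opTensor (M i j) I) y‖ =
      ‖opTensor (matrixOp M) I z‖ := by
    rw [← sq_eq_sq₀ (norm_nonneg _) (norm_nonneg _), ← hnorm, PiLp.norm_sq_eq_of_L2]
    refine Finset.sum_congr rfl fun i _ => ?_
    rw [matrixOp_apply, hz, map_sum, map_sum]
    simp only [Matrix.of_apply, ← hM]
    rfl
  rw [hMy, hyz]
  exact ((opTensor (matrixOp M) I).le_opNorm z).trans
    (mul_le_mul_of_nonneg_right (norm_opTensor_id_right_le _) (norm_nonneg _))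

end MatrixOp

/-! ### The isomorphism of multi-Toeplitz operators and bounded pluriharmonic functions -/

section CompleteIsometry

variable {k : ℕ} {n : Fin k → ℕ} {E : Type v} [NormedAddCommGroup E] [InnerProductSpace ℂ E]
  [CompleteSpace E] {m : ℕ}

/-- The Berezin transform is completely contractive. -/
theorem norm_matrixOp_berezinExt_le {H : Type u} [NormedAddCommGroup H] [InnerProductSpace ℂ H]
    [CompleteSpace H] (X : polyball n H)
    (A : Matrix (Fin m) (Fin m) (HTensor E (Fock.{u} n) →L[ℂ] HTensor E (Fock.{u} n))) :
    ‖matrixOp (Matrix.of fun i j => berezinExt X (A i j))‖ ≤ ‖matrixOp A‖ := by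
  -- The Berezin transform is `W (A ⊗ I) V` with contractions `V` and `W`.
  let V : HTensor E H →L[ℂ] HTensor (HTensor E (Fock.{u} n)) H :=
    ((assoc E (Fock.{u} n) H).symm : _ →L[ℂ] HTensor (HTensor E (Fock.{u} n)) H) ∘L
      opTensor (ContinuousLinearMap.id ℂ E) (berezinKernel X)
  let W : HTensor (HTensor E (Fock.{u} n)) H →L[ℂ] HTensor E H :=
    opTensor (ContinuousLinearMap.id ℂ E) (ContinuousLinearMap.adjoint (berezinKernel X)) ∘L
    (assoc E (Fock.{u} n) H : _ →L[ℂ] HTensor E (HTensor (Fock.{u} n) H))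
  have hV : ∀ x, ‖V x‖ ≤ ‖x‖ := fun x => by
    change ‖(assoc E (Fock.{u} n) H).symm _‖ ≤ _
    rw [LinearIsometryEquiv.norm_map]
    refine (ContinuousLinearMap.le_opNorm _ _).trans (mul_le_of_le_one_left (norm_nonneg _) ?_)
    exact (norm_opTensor_id_le _).trans (norm_berezinKernel_le X)
  have hW : ∀ x, ‖W x‖ ≤ ‖x‖ := fun x => by
    change ‖opTensor _ _ (assoc E (Fock.{u} n) H x)‖ ≤ _
    refine (ContinuousLinearMap.le_opNorm _ _).trans ?_
    rw [LinearIsometryEquiv.norm_map]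
    refine mul_le_of_le_one_left (norm_nonneg _) ((norm_opTensor_id_le _).trans ?_)
    rw [LinearIsometryEquiv.norm_map]
    exact norm_berezinKernel_le X
  refine ContinuousLinearMap.opNorm_le_bound _ (norm_nonneg _) fun x => ?_
  let y : PiLp 2 fun _ : Fin m => HTensor (HTensor E (Fock.{u} n)) H :=
    WithLp.toLp 2 fun j => V (x j)
  have hy : ‖y‖ ≤ ‖x‖ := by
    rw [← pow_le_pow_iff_left₀ (norm_nonneg _) (norm_nonneg _) two_ne_zero,
      PiLp.norm_sq_eq_of_L2, PiLp.norm_sq_eq_of_L2]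
    exact Finset.sum_le_sum fun j _ => pow_le_pow_left₀ (norm_nonneg _) (hV _) 2
  set M := Matrix.of fun i j => opTensor (A i j) (ContinuousLinearMap.id ℂ H)
  have h1 : ‖matrixOp (Matrix.of fun i j => berezinExt X (A i j)) x‖ ≤ ‖matrixOp M y‖ := by
    rw [← pow_le_pow_iff_left₀ (norm_nonneg _) (norm_nonneg _) two_ne_zero,
      PiLp.norm_sq_eq_of_L2, PiLp.norm_sq_eq_of_L2]
    refine Finset.sum_le_sum fun i _ => pow_le_pow_left₀ (norm_nonneg _) ?_ 2
    refine le_trans (le_of_eq (congrArg _ ?_)) (hW _)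
    rw [matrixOp_apply, matrixOp_apply, map_sum]
    rfl
  calc _ ≤ ‖matrixOp M y‖ := h1
    _ ≤ ‖matrixOp M‖ * ‖y‖ := ContinuousLinearMap.le_opNorm _ _
    _ ≤ ‖matrixOp A‖ * ‖x‖ := by
      gcongr
      exact norm_matrixOp_opTensor_le A

theorem berezinExt_mem_minTensor {H : Type u} [NormedAddCommGroup H] [InnerProductSpace ℂ H]
    [CompleteSpace H] (X : polyball n H)
    {A : HTensor E (Fock.{u} n) →L[ℂ] HTensor E (Fock.{u} n)} (hA : A ∈ multiToeplitz n E) :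
    berezinExt X A ∈ minTensor E H := by
  refine (Submodule.isClosed_topologicalClosure _).mem_of_tendsto (hasSum_multiPart X hA)
    (Filter.univ_mem' fun s => ?_)
  exact sum_mem fun m _ => sum_mem fun a _ => sum_mem fun b _ => opTensor_mem_minTensor _ _

/-- The function on the polyball which is the Berezin transform of a multi-Toeplitz operator. -/
noncomputable def berezinFunction (A : multiToeplitz.{u} n E) : PolyballFunction.{u} n E :=
  fun _ X => ⟨berezinExt X A.1, berezinExt_mem_minTensor X A.2⟩

theorem berezinFunction_mem (A : multiToeplitz.{u} n E) :
    berezinFunction A ∈ boundedPluriharmonic.{u} n E :=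
  ⟨⟨entry A.1, fun _ X => hasIterSum_of_hasSum (hasSum_multiPart X A.2)⟩,
    fun _ => ⟨‖A.1‖, fun X => norm_berezinExt_le X A.1⟩⟩

theorem isBoundaryLimit_of_eq_berezinExt {F : PolyballFunction.{u} n E}
    {A : HTensor E (Fock.{u} n) →L[ℂ] HTensor E (Fock.{u} n)} (hA : A ∈ multiToeplitz n E)
    (h : ∀ (H : HilbSpace.{u}) (X : polyball n H), (F H X).1 = berezinExt X A) :
    IsBoundaryLimit F A := fun z =>
  (tendsto_berezinExt_scaledModel hA z).congr fun r => by rw [h]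

/-- The Berezin transform, as a linear map from the multi-Toeplitz operators to the bounded free
pluriharmonic functions. -/
noncomputable def berezinMap :
    multiToeplitz.{u} n E →ₗ[ℂ] boundedPluriharmonic.{u} n E where
  toFun A := ⟨berezinFunction A, berezinFunction_mem A⟩
  map_add' A B := Subtype.ext (funext fun _ => funext fun X => Subtype.ext
    (berezinExt_add X A.1 B.1))
  map_smul' c A := Subtype.ext (funext fun _ => funext fun X => Subtype.ext
    (berezinExt_smul X c A.1))

theorem bijective_berezinMap : Function.Bijective (berezinMap.{u} (n := n) (E := E)) := by
  constructor
  · intro A B hAB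
    have h : ∀ (H : HilbSpace.{u}) (X : polyball n H), berezinExt X A.1 = berezinExt X B.1 :=
      fun H X => congrArg Subtype.val (congrFun (congrFun (congrArg Subtype.val hAB) H) X)
    refine Subtype.ext (ContinuousLinearMap.ext fun z => ?_)
    refine tendsto_nhds_unique (tendsto_berezinExt_scaledModel A.2 z) ?_
    exact (tendsto_berezinExt_scaledModel B.2 z).congr fun r => by
      rw [h ⟨Fock.{u} n⟩]
  · rintro ⟨F, hF, hb⟩
    obtain ⟨A, hA, h⟩ := exists_multiToeplitz hF hb
    exact ⟨⟨A, hA⟩, Subtype.ext (funext fun H => funext fun X => Subtype.ext (h H X).symm)⟩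

/-- The norm of an operator matrix is the supremum of the norms of its Berezin transforms, since
these are contractive and converge strongly to the matrix at the scaled universal model. -/
theorem isLUB_norm_matrixOp_berezinExt
    (A : Matrix (Fin m) (Fin m) (multiToeplitz.{u} n E)) :
    IsLUB {c : ℝ | ∃ (H : HilbSpace.{u}) (X : polyball n H),
        c = ‖matrixOp (K := HTensor E H) (Matrix.of fun i j => berezinExt X (A i j).1)‖}
      ‖matrixOp (K := HTensor E (Fock.{u} n)) (Matrix.of fun i j => (A i j).1)‖ := by
  constructor
  · rintro c ⟨H, X, rfl⟩
    exact norm_matrixOp_berezinExt_le X (Matrix.of fun i j => (A i j).1)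
  · intro c hc
    have hr : ∀ r : Set.Ico (0 : ℝ) 1, ‖matrixOp (K := HTensor E (Fock.{u} n))
        (Matrix.of fun i j => berezinExt
          ⟨scaledModel.{u} n r.1, scaledModel_mem_polyball n r.1 r.2⟩ (A i j).1)‖ ≤ c := fun r =>
      hc ⟨⟨Fock.{u} n⟩, ⟨scaledModel.{u} n r.1, scaledModel_mem_polyball n r.1 r.2⟩, rfl⟩
    -- The point `0 = 0 S` of the polyball shows that an upper bound is nonnegative.
    have hc0 : 0 ≤ c := (norm_nonneg _).trans (hr ⟨0, le_rfl, one_pos⟩)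
    refine ContinuousLinearMap.opNorm_le_bound _ hc0 fun x => ?_
    refine le_of_tendsto (tendsto_matrixOp (fun i j z =>
      tendsto_berezinExt_scaledModel (A i j).2 z) x).norm (Filter.univ_mem' fun r => ?_)
    exact ContinuousLinearMap.le_of_opNorm_le _ (hr r) x

end CompleteIsometry

end Polyball

theorem mainTheorem3 {k : ℕ} (n : Fin k → ℕ) (E : Type v) [NormedAddCommGroup E]
    [InnerProductSpace ℂ E] [CompleteSpace E] :
    -- (i) ⟺ (ii), for functions on the whole (abstract) polyball
    (∀ F : PolyballFunction.{u} n E,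
      (IsFreePluriharmonic F ∧ IsBoundedFunction F) ↔
        ∃ A ∈ multiToeplitz.{u} n E,
          ∀ (H : HilbSpace.{u}) (X : polyball n H), (F H X).1 = berezinExt X A) ∧
    -- (i) ⟺ (ii), for functions on the polyball of one Hilbert space
    (∀ (H : HilbSpace.{u}) (f : polyball n H → minTensor E H),
      (∃ F : PolyballFunction.{u} n E,
        IsFreePluriharmonic F ∧ IsBoundedFunction F ∧ F H = f) ↔
        ∃ A ∈ multiToeplitz.{u} n E, ∀ X : polyball n H, (f X).1 = berezinExt X A) ∧
    -- in this case, `A = SOT-lim F(rS)`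
    (∀ F : PolyballFunction.{u} n E, IsFreePluriharmonic F → IsBoundedFunction F →
      ∀ A ∈ multiToeplitz.{u} n E,
      ∀ H : HilbSpace.{u},
        ¬ FiniteDimensional ℂ H → (∀ X : polyball n H, (F H X).1 = berezinExt X A) →
          IsBoundaryLimit F A) ∧
    -- `F ↦ A` is a completely isometric isomorphism
    ∃ Φ : boundedPluriharmonic.{u} n E ≃ₗ[ℂ] multiToeplitz.{u} n E,
      (∀ F : boundedPluriharmonic.{u} n E,
        (∀ (H : HilbSpace.{u}) (X : polyball n H), (F.1 H X).1 = berezinExt X (Φ F).1) ∧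
        IsBoundaryLimit F.1 (Φ F).1) ∧
      ∀ (m : ℕ) (F : Matrix (Fin m) (Fin m) (boundedPluriharmonic.{u} n E)),
        IsLUB {c : ℝ | ∃ (H : HilbSpace.{u}) (X : polyball n H),
            c = ‖matrixOp (K := HTensor E H) (Matrix.of fun i j => ((F i j).1 H X).1)‖}
          ‖matrixOp (K := HTensor E (Fock.{u} n)) (Matrix.of fun i j => (Φ (F i j)).1)‖ := by
  have hback : ∀ F : PolyballFunction.{u} n E, (∃ A ∈ multiToeplitz.{u} n E,
      ∀ (H : HilbSpace.{u}) (X : polyball n H), (F H X).1 = berezinExt X A) →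
      IsFreePluriharmonic F ∧ IsBoundedFunction F := by
    rintro F ⟨A, hA, h⟩
    obtain rfl : F = berezinFunction ⟨A, hA⟩ :=
      funext fun H => funext fun X => Subtype.ext (h H X)
    exact berezinFunction_mem ⟨A, hA⟩
  refine ⟨fun F => ⟨fun h => exists_multiToeplitz h.1 h.2, hback F⟩, fun H f => ⟨?_, ?_⟩, ?_, ?_⟩
  · rintro ⟨F, hF, hb, rfl⟩
    obtain ⟨A, hA, h⟩ := exists_multiToeplitz hF hb
    exact ⟨A, hA, h H⟩
  · rintro ⟨A, hA, h⟩
    obtain ⟨hF, hb⟩ := berezinFunction_mem ⟨A, hA⟩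
    exact ⟨_, hF, hb, funext fun X => Subtype.ext (h X).symm⟩
  · intro F hF hb A hA H hH h
    obtain ⟨B, hB, hFB⟩ := exists_multiToeplitz hF hb
    obtain rfl : A = B := eq_of_berezinExt_eq hH hA hB fun X => (h X).symm.trans (hFB H X)
    exact isBoundaryLimit_of_eq_berezinExt hA hFB
  · let e := LinearEquiv.ofBijective (berezinMap.{u} (n := n) (E := E)) bijective_berezinMap
    have he : ∀ (F : boundedPluriharmonic.{u} n E) (H : HilbSpace.{u}) (X : polyball n H),
        (F.1 H X).1 = berezinExt X (e.symm F).1 := fun F H X => by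
      conv_lhs => rw [← e.apply_symm_apply F]
      rfl
    refine ⟨e.symm, fun F => ⟨he F, isBoundaryLimit_of_eq_berezinExt (e.symm F).2 (he F)⟩,
      fun m F => ?_⟩
    simp only [he]
    exact isLUB_norm_matrixOp_berezinExt (Matrix.of fun i j => e.symm (F i j))
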